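/- Let $\alpha,\beta,\kappa,\lambda\in\mathbb{R}$ with $\alpha,\beta,\kappa\neq 0$. Then the Hide–Skeldon–Acheson (HSA) dynamo \[ \dot x=x(y-1)-\beta z,\qquad \dot y=\alpha(1-x^2)-\kappa y,\qquad \dot z=x-\lambda z \] admits no polynomial first integral, no rational first integral and no Darboux first integral. Here the following terminology is used. Let $\mathfrak X=[x(y-1)-\beta z]\partial_x+[\alpha(1-x^2)-\kappa y]\partial_y+[x-\lambda z]\partial_z$. A first integral is a nonconstant continuous function $H\colon U\to\mathbb{C}$ on a nonempty connected open set $U\subset\mathbb{R}^3$ that is constant along every solution of the system on every open time interval during which the solution stays in $U$ (real-valued functions are included). It is polynomial if it is the restriction to $U$ of a polynomial in $\mathbb{C}[x,y,z]$, and rational if there are $P,Q\in\mathbb{C}[x,y,z]$, $Q\ne0$, with $H=P/Q$ at all points of $U$ where $Q\neq0$. A Darboux polynomial is a nonconstant $f\in\mathbb{C}[x,y,z]$ with $\mathfrak X f=Kf$ for some $K\in\mathbb{C}[x,y,z]$. An exponential factor is a nonconstant function $e^{g/h}$ with $g,h\in\mathbb{C}[x,y,z]$ coprime, $h\ne 0$,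 and $\mathfrak X(g/h)=L$ for some $L\in\mathbb{C}[x,y,z]$ of degree at most $1$. A Darboux first integral is a first integral $G\colon U\to\mathbb{C}$ of the form \[ G=f_1^{\lambda_1}\cdots f_p^{\lambda_p}\,\Big[\exp\Big(\frac{g_1}{h_1}\Big)\Big]^{\mu_1}\cdots\Big[\exp\Big(\frac{g_q}{h_q}\Big)\Big]^{\mu_q}, \] where the $f_j$ are Darboux polynomials, the $\exp(g_k/h_k)$ are exponential factors and $\lambda_j,\mu_k\in\mathbb{C}$. That is, near each point of $U$ at which no $f_j$ and no $h_k$ vanishes, $G=\prod_j e^{\lambda_j\ell_j}\prod_k e^{\mu_k g_k/h_k}$ for some continuous branches $\ell_j$ of $\log f_j$. -/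

import Mathlib

namespace HSA

/-- The vector field on `ℝ³` (coordinates `v 0 = x`, `v 1 = y`, `v 2 = z`) of the HSA dynamo
`x' = x (y - 1) - β z`, `y' = α (1 - x²) - κ y`, `z' = x - lam z`. -/
def vectorField (α β κ lam : ℝ) (v : Fin 3 → ℝ) : Fin 3 → ℝ :=
  ![v 0 * (v 1 - 1) - β * v 2, α * (1 - v 0 ^ 2) - κ * v 1, v 0 - lam * v 2]

/-- `γ` solves the HSA dynamo on the open time interval `(a, b)`. -/
def IsSolutionOn (α β κ lam a b : ℝ) (γ : ℝ → Fin 3 → ℝ) : Prop :=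
  ∀ t ∈ Set.Ioo a b, HasDerivAt γ (vectorField α β κ lam (γ t)) t

/-- `H` is a first integral of the HSA dynamo on the nonempty connected open set `U`: a continuous
nonconstant function on `U` that is constant along every solution, as long as it stays in `U`.
Complex values are allowed; a real first integral is the special case of real values. -/
structure IsFirstIntegralOn (α β κ lam : ℝ) (U : Set (Fin 3 → ℝ)) (H : (Fin 3 → ℝ) → ℂ) :
    Prop where
  isOpen : IsOpen U
  isConnected : IsConnected U
  continuousOn : ContinuousOn H U
  nonconstant : ∃ v ∈ U, ∃ w ∈ U, H v ≠ H w
  constant_along : ∀ (a b : ℝ) (γ : ℝ → Fin 3 → ℝ), IsSolutionOn α β κ lam a b γ →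
    (∀ t ∈ Set.Ioo a b, γ t ∈ U) →
    ∀ s ∈ Set.Ioo a b, ∀ t ∈ Set.Ioo a b, H (γ s) = H (γ t)

/-- The value of a polynomial in `ℂ[x, y, z]` at a real point. -/
noncomputable def evalAt (p : MvPolynomial (Fin 3) ℂ) (v : Fin 3 → ℝ) : ℂ :=
  MvPolynomial.eval (fun i => (v i : ℂ)) p

/-- The vector field of the HSA dynamo as a differential operator on `ℂ[x, y, z]`. -/
noncomputable def fieldOp (α β κ lam : ℝ) (p : MvPolynomial (Fin 3) ℂ) :
    MvPolynomial (Fin 3) ℂ :=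
  (MvPolynomial.X 0 * (MvPolynomial.X 1 - 1) - MvPolynomial.C (β : ℂ) * MvPolynomial.X 2)
      * MvPolynomial.pderiv 0 p
    + (MvPolynomial.C (α : ℂ) * (1 - MvPolynomial.X 0 ^ 2)
        - MvPolynomial.C (κ : ℂ) * MvPolynomial.X 1) * MvPolynomial.pderiv 1 p
    + (MvPolynomial.X 0 - MvPolynomial.C (lam : ℂ) * MvPolynomial.X 2) * MvPolynomial.pderiv 2 p

/-- Darboux polynomials: nonconstant `f` with `𝔛 f = K f` for some polynomial `K`. -/
def IsDarbouxPolynomial (α β κ lam : ℝ) (f : MvPolynomial (Fin 3) ℂ) : Prop :=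
  (∀ c : ℂ, f ≠ MvPolynomial.C c) ∧
    ∃ K : MvPolynomial (Fin 3) ℂ, fieldOp α β κ lam f = K * f

/-- `exp (g / h)` is an exponential factor: `g` and `h ≠ 0` are coprime, `g / h` is not constant,
and `𝔛 (g / h) = L` for some polynomial `L` of degree at most one (written without
denominators), that is, `𝔛 (exp (g / h)) = L exp (g / h)`. -/
def IsExponentialFactor (α β κ lam : ℝ) (g h : MvPolynomial (Fin 3) ℂ) : Prop :=
  h ≠ 0 ∧ IsRelPrime g h ∧ (∀ c : ℂ, g ≠ MvPolynomial.C c * h) ∧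
    ∃ L : MvPolynomial (Fin 3) ℂ, L.totalDegree ≤ 1 ∧
      fieldOp α β κ lam g * h - g * fieldOp α β κ lam h = L * h ^ 2

/-- On `U`, the function `G` is of the form
`f₁ ^ e₁ ⋯ f_p ^ e_p * exp (g₁ / h₁) ^ m₁ ⋯ exp (g_q / h_q) ^ m_q` with complex exponents,
Darboux polynomials `f_j` and exponential factors `exp (g_k / h_k)`: near every point of `U` where
no `f_j` and no `h_k` vanishes, `G` is given by this formula for some continuous choice `ℓ_j` of
the logarithms of the `f_j`. -/
def IsOfDarbouxTypeOn (α β κ lam : ℝ) (U : Set (Fin 3 → ℝ)) (G : (Fin 3 → ℝ) → ℂ) : Prop :=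
  ∃ (p q : ℕ) (f : Fin p → MvPolynomial (Fin 3) ℂ) (e : Fin p → ℂ)
    (g h : Fin q → MvPolynomial (Fin 3) ℂ) (m : Fin q → ℂ),
    (∀ j, IsDarbouxPolynomial α β κ lam (f j)) ∧
    (∀ k, IsExponentialFactor α β κ lam (g k) (h k)) ∧
    ∀ v ∈ U, (∀ j, evalAt (f j) v ≠ 0) → (∀ k, evalAt (h k) v ≠ 0) →
      ∃ V ∈ nhds v, ∃ ℓ : Fin p → (Fin 3 → ℝ) → ℂ,
        (∀ j, ContinuousOn (ℓ j) V ∧ ∀ w ∈ V, Complex.exp (ℓ j w) = evalAt (f j) w) ∧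
        ∀ w ∈ V, G w = (∏ j, Complex.exp (e j * ℓ j w)) *
          ∏ k, Complex.exp (m k * (evalAt (g k) w / evalAt (h k) w))

/-- Some polynomial is a first integral on some domain. -/
def HasPolynomialFirstIntegral (α β κ lam : ℝ) : Prop :=
  ∃ (U : Set (Fin 3 → ℝ)) (p : MvPolynomial (Fin 3) ℂ),
    IsFirstIntegralOn α β κ lam U (evalAt p)

/-- Some first integral on some domain is a quotient `p / q` of polynomials, wherever `q` does not
vanish. -/
def HasRationalFirstIntegral (α β κ lam : ℝ) : Prop :=
  ∃ (U : Set (Fin 3 → ℝ)) (H : (Fin 3 → ℝ) → ℂ) (p q : MvPolynomial (Fin 3) ℂ),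
    q ≠ 0 ∧ IsFirstIntegralOn α β κ lam U H ∧
      ∀ v ∈ U, evalAt q v ≠ 0 → H v = evalAt p v / evalAt q v

/-- Some first integral on some domain is of Darboux type. -/
def HasDarbouxFirstIntegral (α β κ lam : ℝ) : Prop :=
  ∃ (U : Set (Fin 3 → ℝ)) (G : (Fin 3 → ℝ) → ℂ),
    IsFirstIntegralOn α β κ lam U G ∧ IsOfDarbouxTypeOn α β κ lam U G

end HSA

namespace HSA

open MvPolynomial Filter Topology

/-! Over `ℂ`, take `s² = -α` and the coordinates `u = y + s x`, `v = y - s x`, `Z = 2 s β z` of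
weights 1, 1, 2. Twice the field becomes `modelOp`; its leading part `(u - v)(u∂ᵤ - v∂ᵥ) - Z(∂ᵤ -
∂ᵥ)` raises the weight by one, and the rest never raises it.

Let `h` be a nonzero polynomial with a cofactor. The leading part forces the top layer of `h` to be
`c Z^j` and the cofactor to be constant (`top_layer`). The next layer vanishes and the cofactor is
`-2 lam j` (`second_layer`). If `j ≥ 1`, two further layers give `κ = lam` (`eq_of_third_layer`).
Moreover every `g` with `𝔛 g = K g + c₀ h` is a multiple of `h` (`eq_C_mul_of_modelOp`): eigenspaces
are lines, without Jordan blocks. Hence a rational function whose derivative along the field is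
constant is itself constant (`eq_C_mul_of_fieldOp_div`).

This settles rational, hence polynomial, first integrals. For Darboux type, `log G = ∑ e_j log f_j +
A/B` locally, where `f_j` has cofactor `-lam a_j` with `a_j ≥ 1`. Differentiating along solutions
gives `𝔛(A/B) = lam ∑ e_j a_j`, so `A/B` is constant and this sum is zero. Equal eigenvalues make
`f_j^(a_k)` and `f_k^(a_j)` proportional, so the forms `dlog f_j / a_j` all agree, and `d log G` is
a multiple of `∑ e_j a_j = 0`. -/

/-! ### Vanishing of layers under the leading part -/

/-- The coefficient of `u ^ a * v ^ b * Z ^ i` in the leading part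
`(u - v) (u ∂ᵤ - v ∂ᵥ) - Z (∂ᵤ - ∂ᵥ)` of the field applied to a polynomial with coefficients `C`. -/
def leadCoeff (C : ℤ → ℤ → ℤ → ℂ) (a b i : ℤ) : ℂ :=
  (a - 1 - b) * C (a - 1) b i - (a - b + 1) * C a (b - 1) i
    - (a + 1) * C (a + 1) b (i - 1) + (b + 1) * C a (b + 1) (i - 1)

/-- The coefficient of `u ^ a * v ^ b * Z ^ i` in the remaining part of the field. -/
def restCoeff (α β κ lam : ℂ) (C : ℤ → ℤ → ℤ → ℂ) (a b i : ℤ) : ℂ :=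
  2 * α * ((a + 1) * C (a + 1) b i + (b + 1) * C a (b + 1) i)
    - (κ + 1) * (a + b) * C a b i
    + (1 - κ) * ((a + 1) * C (a + 1) (b - 1) i + (b + 1) * C (a - 1) (b + 1) i)
    + 2 * β * (i + 1) * (C (a - 1) b (i + 1) - C a (b - 1) (i + 1))
    - 2 * lam * i * C a b i

section

variable {C : ℤ → ℤ → ℤ → ℂ}

/-- Zeros at negative indices propagate upward through a two-term recurrence for as long as the
factor `y` of the new term is nonzero. -/
theorem eq_zero_of_recurrence {D x y : ℤ → ℂ} {A : ℤ} (h0 : ∀ a < 0, D a = 0)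
    (h : ∀ a ≤ A, 0 ≤ a → y a ≠ 0 ∧ y a * D a = x a * D (a - 1)) : ∀ a ≤ A, D a = 0 := by
  have key : ∀ m : ℕ, ∀ a : ℤ, a < m → a ≤ A → D a = 0 := by
    intro m
    induction m with
    | zero => intro a ha _; exact h0 a (by exact_mod_cast ha)
    | succ m ih =>
      intro a ha hA
      by_cases hneg : a < 0
      · exact h0 a hneg
      · obtain ⟨hy, he⟩ := h a hA (by omega)
        rw [ih (a - 1) (by push_cast at ha; omega) (by omega), mul_zero] at he
        exact (mul_eq_zero.mp he).resolve_left hy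
  intro a ha
  exact key (a.toNat + 1) a (by push_cast; omega) ha

theorem intCast_ne_zero' {k : ℤ} (h : k ≠ 0) : (k : ℂ) ≠ 0 := by exact_mod_cast h

/-- Off the diagonal, a layer is determined by the previous one. -/
theorem offDiag_eq_zero (hneg : ∀ a b i, a < 0 ∨ b < 0 ∨ i < 0 → C a b i = 0) {W i : ℤ}
    (hE : ∀ a b, a + b + 2 * i = W + 1 → leadCoeff C a b i = 0)
    (hprev : ∀ a b, a + b + 2 * (i - 1) = W → C a b (i - 1) = 0) :
    ∀ a b, a + b + 2 * i = W → a ≠ b → C a b i = 0 := by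
  intro a b hab hne
  rcases lt_or_gt_of_ne hne with hlt | hlt
  -- The factor `a - b` of the new coefficient vanishes only on the diagonal. The half `a < b` is
  -- swept upward in `a`, the half `a > b` upward in `b`.
  · have := eq_zero_of_recurrence (D := fun k => C k (W - 2 * i - k) i)
      (x := fun k => (k - 1 - ((W - 2 * i - k : ℤ) + 1) : ℂ))
      (y := fun k => (k - (W - 2 * i - k : ℤ) : ℂ)) (A := a)
      (fun k hk => hneg _ _ _ (Or.inl hk)) ?_ a le_rfl
    · rwa [show b = W - 2 * i - a by omega]
    · intro k hk _
      refine ⟨?_, ?_⟩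
      · have : (k - (W - 2 * i - k : ℤ) : ℤ) ≠ 0 := by omega
        exact_mod_cast this
      · have h := hE k (W - 2 * i - k + 1) (by ring)
        rw [leadCoeff, hprev _ _ (by ring), hprev _ _ (by ring),
          show W - 2 * i - k + 1 - 1 = W - 2 * i - k by ring,
          show W - 2 * i - k + 1 = W - 2 * i - (k - 1) by ring] at h
        push_cast at h ⊢
        linear_combination -h
  · have := eq_zero_of_recurrence (D := fun k => C (W - 2 * i - k) k i)
      (x := fun k => ((W - 2 * i - k : ℤ) + 1 - k + 1 : ℂ))
      (y := fun k => ((W - 2 * i - k : ℤ) - k : ℂ)) (A := b)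
      (fun k hk => hneg _ _ _ (Or.inr (Or.inl hk))) ?_ b le_rfl
    · rwa [show a = W - 2 * i - b by omega]
    · intro k hk _
      refine ⟨?_, ?_⟩
      · have : ((W - 2 * i - k : ℤ) - k : ℤ) ≠ 0 := by omega
        exact_mod_cast this
      · have h := hE (W - 2 * i - k + 1) k (by ring)
        rw [leadCoeff, hprev _ _ (by ring), hprev _ _ (by ring),
          show W - 2 * i - k + 1 - 1 = W - 2 * i - k by ring,
          show W - 2 * i - k + 1 = W - 2 * i - (k - 1) by ring] at h
        push_cast at h ⊢
        linear_combination h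

/-- In odd weight `a + b` is odd, so there is no diagonal, and induction on the power of `Z` meets
no obstruction. -/
theorem odd_layers_eq_zero (hneg : ∀ a b i, a < 0 ∨ b < 0 ∨ i < 0 → C a b i = 0) {W I : ℤ}
    (hW : Odd W) (hE : ∀ a b i, a + b + 2 * i = W + 1 → i < I → leadCoeff C a b i = 0) :
    ∀ a b i, a + b + 2 * i = W → i < I → C a b i = 0 := by
  have key : ∀ k : ℕ, ∀ a b i : ℤ, a + b + 2 * i = W → i < I → i < k → C a b i = 0 := by
    intro k
    induction k with
    | zero => intro a b i _ _ hi; exact hneg _ _ _ (Or.inr (Or.inr (by exact_mod_cast hi)))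
    | succ k ih =>
      intro a b i hab hI hi
      refine offDiag_eq_zero hneg (fun a b h => hE a b i h hI)
        (fun a b h => ih a b (i - 1) h (by omega) (by push_cast at hi; omega)) a b hab ?_
      rintro rfl
      obtain ⟨w, hw⟩ := hW
      omega
  intro a b i hab hI
  exact key (i.toNat + 1) a b i hab hI (by push_cast; omega)

/-- The term `u^m v^m Z^i` is invisible to the part of the field that keeps the power of `Z`. It is
detected one power of `Z` higher, as the obstruction to solving for the next coefficients. -/
theorem diag_eq_zero (hneg : ∀ a b i, a < 0 ∨ b < 0 ∨ i < 0 → C a b i = 0) {W i m : ℤ}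
    (hE : ∀ a b, a + b + 2 * (i + 1) = W + 1 → leadCoeff C a b (i + 1) = 0)
    (hoff : ∀ a b, a + b + 2 * i = W → a ≠ b → C a b i = 0) (hm : 1 ≤ m)
    (hW : m + m + 2 * i = W) : C m m i = 0 := by
  have hlow : C (m - 2) m (i + 1) = 0 := by
    have := eq_zero_of_recurrence (D := fun k => C k (2 * m - 2 - k) (i + 1))
      (x := fun k => (k - 1 - ((2 * m - 2 - k : ℤ) + 1) : ℂ))
      (y := fun k => (k - (2 * m - 2 - k : ℤ) : ℂ)) (A := m - 2)
      (fun k hk => hneg _ _ _ (Or.inl hk)) ?_ (m - 2) le_rfl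
    · simpa [show 2 * m - 2 - (m - 2) = m by ring] using this
    · intro k hk _
      refine ⟨?_, ?_⟩
      · have : (k - (2 * m - 2 - k : ℤ) : ℤ) ≠ 0 := by omega
        exact_mod_cast this
      · have h := hE k (2 * m - 2 - k + 1) (by omega)
        rw [leadCoeff, show i + 1 - 1 = i by ring, hoff _ _ (by omega) (by omega),
          hoff _ _ (by omega) (by omega),
          show 2 * m - 2 - k + 1 - 1 = 2 * m - 2 - k by ring,
          show 2 * m - 2 - k + 1 = 2 * m - 2 - (k - 1) by ring] at h
        push_cast at h ⊢
        linear_combination -h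
  -- Here the unknown diagonal coefficient `C (m - 1) (m - 1) (i + 1)` has factor zero, so that only
  -- `m * C m m i` survives.
  have h := hE (m - 1) m (by omega)
  rw [leadCoeff, show i + 1 - 1 = i by ring, hoff (m - 1) _ (by omega) (by omega),
    show m - 1 - 1 = m - 2 by ring, hlow, show m - 1 + 1 = m by ring] at h
  push_cast at h
  have h' : (m : ℂ) * C m m i = 0 := by linear_combination -h
  exact (mul_eq_zero.mp h').resolve_left (intCast_ne_zero' (by omega))

/-- Killing a diagonal term at `i` takes the equations at `i + 1`, hence the bound `I - 1` in the
first conclusion; off the diagonal the equations at `i` suffice. -/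
theorem even_layers_eq_zero (hneg : ∀ a b i, a < 0 ∨ b < 0 ∨ i < 0 → C a b i = 0) {W I : ℤ}
    (hI : 2 * I ≤ W)
    (hE : ∀ a b i, a + b + 2 * i = W + 1 → i < I → leadCoeff C a b i = 0) :
    (∀ a b i, a + b + 2 * i = W → i < I - 1 → C a b i = 0) ∧
      ∀ a b i, a + b + 2 * i = W → i < I → a ≠ b → C a b i = 0 := by
  have key : ∀ k : ℕ, ∀ a b i : ℤ, a + b + 2 * i = W → i < I - 1 → i < k → C a b i = 0 := by
    intro k
    induction k with
    | zero => intro a b i _ _ hi; exact hneg _ _ _ (Or.inr (Or.inr (by exact_mod_cast hi)))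
    | succ k ih =>
      intro a b i hab hI' hi
      have hoff := offDiag_eq_zero hneg (fun a b h => hE a b i h (by omega))
        (fun a b h => ih a b (i - 1) h (by omega) (by push_cast at hi; omega))
      by_cases hne : a = b
      · subst hne
        exact diag_eq_zero hneg (fun a b h => hE a b (i + 1) h (by omega)) hoff (by omega) hab
      · exact hoff a b hab hne
  have h1 : ∀ a b i, a + b + 2 * i = W → i < I - 1 → C a b i = 0 := fun a b i hab hI' =>
    key (i.toNat + 1) a b i hab hI' (by push_cast; omega)
  refine ⟨h1, fun a b i hab hI' hne => ?_⟩
  exact offDiag_eq_zero hneg (fun a b h => hE a b i h hI')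
    (fun a b h => h1 a b (i - 1) h (by omega)) a b hab hne

end

/-! ### The top layers of an eigenpolynomial -/

section

variable {C : ℤ → ℤ → ℤ → ℂ}

/-- Let `Z^j` be the lowest power of `Z` in the top layer, with coefficients `c` in `u, v` of degree
`N`, and let `d` belong to `Z^(j+1)`. The equations at `Z^j` tie `p, q` to the ends of the support
of `c`. Solvability for `d` forces full support, then `c` proportional to `(u - v)^N`, and finally
`N = 0`. -/
theorem top_layer (hneg : ∀ a b i, a < 0 ∨ b < 0 ∨ i < 0 → C a b i = 0) {n : ℤ} {p q : ℂ}
    (hE : ∀ a b i, a + b + 2 * i = n + 1 →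
      leadCoeff C a b i = p * C (a - 1) b i + q * C a (b - 1) i)
    (hne : ∃ a b i, a + b + 2 * i = n ∧ C a b i ≠ 0) :
    p = 0 ∧ q = 0 ∧ ∃ j, n = 2 * j ∧ C 0 0 j ≠ 0 ∧
      ∀ a b i, a + b + 2 * i = n → i ≠ j → C a b i = 0 := by
  have pos : ∀ {a b i}, C a b i ≠ 0 → 0 ≤ a ∧ 0 ≤ b ∧ 0 ≤ i := by
    intro a b i h
    by_contra hc
    exact h (hneg a b i (by omega))
  obtain ⟨j, ⟨a', b', hab', hC'⟩, hjmin⟩ := Int.exists_least_of_bdd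
    (P := fun i => ∃ a b, a + b + 2 * i = n ∧ C a b i ≠ 0)
    ⟨0, fun i ⟨a, b, _, h⟩ => (pos h).2.2⟩ (by obtain ⟨a, b, i, h⟩ := hne; exact ⟨i, a, b, h⟩)
  have hlow : ∀ a b i, a + b + 2 * i = n → i < j → C a b i = 0 := by
    intro a b i hab hi
    by_contra h
    exact absurd (hjmin i ⟨a, b, hab, h⟩) (by omega)
  set N := n - 2 * j with hN
  obtain ⟨c, hc⟩ : ∃ c : ℤ → ℂ, c = fun a => C a (N - a) j := ⟨_, rfl⟩
  obtain ⟨d, hd⟩ : ∃ d : ℤ → ℂ, d = fun a => C a (N - 2 - a) (j + 1) := ⟨_, rfl⟩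
  have hcC : ∀ a b, a + b = N → C a b j = c a := by
    rintro a b h
    simp only [hc, ← h, add_sub_cancel_left]
  have hdC : ∀ a b, a + b = N - 2 → C a b (j + 1) = d a := by
    rintro a b h
    simp only [hd, ← h, add_sub_cancel_left]
  have hcpos : ∀ a, c a ≠ 0 → 0 ≤ a ∧ a ≤ N := by
    intro a h
    rw [hc] at h
    have := pos h
    omega
  have hcex : ∃ a, c a ≠ 0 := ⟨a', by rwa [← hcC a' b' (by omega)]⟩
  obtain ⟨l, hl, hlmin⟩ := Int.exists_least_of_bdd (P := fun a => c a ≠ 0)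
    ⟨0, fun a h => (hcpos a h).1⟩ hcex
  obtain ⟨r, hr, hrmax⟩ := Int.exists_greatest_of_bdd (P := fun a => c a ≠ 0)
    ⟨N, fun a h => (hcpos a h).2⟩ hcex
  have hc0 : ∀ a, a < l ∨ r < a → c a = 0 := by
    intro a h
    by_contra hca
    have h1 := hlmin a hca
    have h2 := hrmax a hca
    omega
  have hlr : l ≤ r := hlmin r hr
  have hrec : ∀ a : ℤ, (2 * a - N - 2 - p) * c (a - 1) = (2 * a - N + q) * c a := by
    intro a
    have h := hE a (N + 1 - a) j (by omega)
    rw [leadCoeff, hlow _ _ (j - 1) (by omega) (by omega),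
      hlow _ _ (j - 1) (by omega) (by omega),
      hcC (a - 1) _ (by omega), hcC a _ (by omega)] at h
    push_cast at h
    linear_combination h
  have hq : q = N - 2 * l := by
    have h := hrec l
    rw [hc0 (l - 1) (by omega), mul_zero] at h
    have := (mul_eq_zero.mp h.symm).resolve_right hl
    linear_combination this
  have hp : p = 2 * r - N := by
    have h := hrec (r + 1)
    rw [hc0 (r + 1) (by omega), mul_zero, add_sub_cancel_right] at h
    have := (mul_eq_zero.mp h).resolve_right hr
    push_cast at this
    linear_combination -this
  have hrec' : ∀ a : ℤ, 2 * (a - r) * d (a - 1) - 2 * (a + 1 - l) * d a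
      = (a + 1) * c (a + 1) - (N - a) * c a := by
    intro a
    have h := hE a (N - 1 - a) (j + 1) (by omega)
    rw [leadCoeff, show j + 1 - 1 = j by ring, hcC _ _ (by omega), hcC _ _ (by omega),
      hdC _ _ (by omega), hdC _ _ (by omega)] at h
    push_cast at h
    rw [hp, hq] at h
    linear_combination h
  have hdneg : ∀ a < 0, d a = 0 := fun a ha => by rw [hd]; exact hneg _ _ _ (Or.inl ha)
  have hdneg' : ∀ a, N - 2 < a → d a = 0 := fun a ha => by
    rw [hd]; exact hneg _ _ _ (Or.inr (Or.inl (by omega)))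
  -- If `l > 0`, sweeping `d` from the left gives `d (l - 2) = 0`. At `a = l - 1` the factor of `d
  -- (l - 1)` vanishes, leaving `l * c l = 0`. The right end is symmetric.
  have hl0 : l = 0 := by
    by_contra hl0
    have hlpos : 1 ≤ l := by have := (hcpos l hl).1; omega
    have hz := eq_zero_of_recurrence (D := d) (x := fun a => (a - r : ℂ))
      (y := fun a => (a + 1 - l : ℂ)) (A := l - 2) hdneg ?_ (l - 2) le_rfl
    · have h := hrec' (l - 1)
      rw [show l - 1 - 1 = l - 2 by ring, hz, show l - 1 + 1 = l by ring,
        hc0 (l - 1) (by omega)] at h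
      push_cast at h
      have h' : (l : ℂ) * c l = 0 := by linear_combination -h
      exact (mul_eq_zero.mp h').elim (intCast_ne_zero' hl0) hl
    · intro a ha _
      refine ⟨?_, ?_⟩
      · have : a + 1 - l ≠ 0 := by omega
        exact_mod_cast this
      · have h := hrec' a
        rw [hc0 a (by omega), hc0 (a + 1) (by omega)] at h
        linear_combination -h / 2
  have hrN : r = N := by
    by_contra hrN
    have hrlt : r < N := by have := (hcpos r hr).2; omega
    have hz := eq_zero_of_recurrence (D := fun b => d (N - 2 - b))
      (x := fun b => ((N - 2 - b : ℤ) + 1 + 1 - l : ℂ))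
      (y := fun b => ((N - 2 - b : ℤ) + 1 - r : ℂ)) (A := N - 2 - r)
      (fun b hb => hdneg' _ (by omega)) ?_ (N - 2 - r) le_rfl
    · rw [show N - 2 - (N - 2 - r) = r by ring] at hz
      have h := hrec' r
      rw [hz, hc0 (r + 1) (by omega)] at h
      have h' : ((N - r : ℤ) : ℂ) * c r = 0 := by push_cast; linear_combination h
      exact (mul_eq_zero.mp h').elim (intCast_ne_zero' (by omega)) hr
    · intro b hb _
      refine ⟨?_, ?_⟩
      · have : (N - 2 - b : ℤ) + 1 - r ≠ 0 := by omega
        exact_mod_cast this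
      · have h := hrec' (N - 2 - b + 1)
        rw [hc0 (N - 2 - b + 1) (by omega), hc0 (N - 2 - b + 1 + 1) (by omega),
          show N - 2 - b + 1 - 1 = N - 2 - b by ring] at h
        rw [show N - 2 - (b - 1) = N - 2 - b + 1 by ring]
        push_cast at h ⊢
        linear_combination h / 2
  subst hl0
  rw [hrN] at hr hp hrec'
  -- With full support `p = q = N`, and this is the recurrence for the coefficients of `(u - v)^N`.
  have hbin : ∀ a : ℤ, (a + 1) * c (a + 1) = -(N - a) * c a := by
    intro a
    have h := hrec (a + 1)
    rw [hp, hq, add_sub_cancel_right] at h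
    push_cast at h
    linear_combination -h / 2
  have hdc : ∀ m : ℕ, d m = -(m + 1) * c (m + 1) := by
    have step : ∀ m : ℤ, m ≠ -1 → d (m - 1) = -m * c m → d m = -(m + 1) * c (m + 1) := by
      intro m hm h1
      have h := hrec' m
      have h2 := hbin m
      rw [h1] at h
      have hm' : ((m + 1 : ℤ) : ℂ) ≠ 0 := intCast_ne_zero' (by omega)
      push_cast at hm'
      apply mul_left_cancel₀ hm'
      push_cast at h
      linear_combination -h / 2 + (1 / 2 + m) * h2
    intro m
    induction m with
    | zero =>
      have := step 0 (by norm_num) (by rw [hdneg _ (by norm_num)]; simp)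
      simpa using this
    | succ m ih =>
      have := step (m + 1) (by omega) (by simpa [add_sub_cancel_right] using ih)
      push_cast at this ⊢
      simpa using this
  -- The solution `d` would have `d (N - 1) = -N * c N`, but that entry carries the exponent `-1` of
  -- `v`, so it is zero.
  have hN0 : N = 0 := by
    by_contra hN0
    have hNpos : 1 ≤ N := by have := (hcpos N hr).1; omega
    have h := hdc (N - 1).toNat
    have hcast : (((N - 1).toNat : ℕ) : ℤ) = N - 1 := by omega
    have hcast' : (((N - 1).toNat : ℕ) : ℂ) = N - 1 := by
      have := congrArg (Int.cast : ℤ → ℂ) hcast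
      push_cast at this
      exact this
    rw [hcast, hcast', hdneg' _ (by omega), sub_add_cancel, sub_add_cancel] at h
    have h' : (N : ℂ) * c N = 0 := by linear_combination h
    exact (mul_eq_zero.mp h').elim (intCast_ne_zero' hN0) hr
  refine ⟨by rw [hp, hN0]; simp, by rw [hq, hN0]; simp, j, by omega, ?_, ?_⟩
  · rw [hcC 0 0 (by omega)]
    rwa [hN0] at hr
  · intro a b i hab hi
    rcases lt_or_gt_of_ne hi with h | h
    · exact hlow a b i hab h
    · exact hneg a b i (by omega)

/-- The weight `2j - 1` is odd, so nothing survives there, and the coefficient of `Z^j` then reads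
off the eigenvalue. The source `R` allows reuse for generalized eigenvectors, also when the
coefficient of `Z^j` is zero. -/
theorem second_layer {α β κ lam : ℂ}
    (hneg : ∀ a b i, a < 0 ∨ b < 0 ∨ i < 0 → C a b i = 0) {j : ℤ} {k : ℂ}
    {R : ℤ → ℤ → ℤ → ℂ}
    (hE : ∀ a b i, a + b + 2 * i = 2 * j →
      leadCoeff C a b i + restCoeff α β κ lam C a b i = k * C a b i + R a b i)
    (hR : ∀ a b i, a + b + 2 * i = 2 * j → i < j → R a b i = 0)
    (hhigh : ∀ a b i, 2 * j < a + b + 2 * i → C a b i = 0)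
    (htop : ∀ a b i, a + b + 2 * i = 2 * j → i ≠ j → C a b i = 0) :
    (∀ a b i, a + b + 2 * i = 2 * j - 1 → C a b i = 0) ∧
      -2 * lam * j * C 0 0 j = k * C 0 0 j + R 0 0 j := by
  have hlow := odd_layers_eq_zero hneg (W := 2 * j - 1) (I := j) ⟨j - 1, by ring⟩ (by
    intro a b i hab hi
    have h := hE a b i (by omega)
    rw [hR a b i (by omega) hi, htop a b i (by omega) (by omega), restCoeff,
      hhigh _ _ _ (by omega), hhigh _ _ _ (by omega), htop a b i (by omega) (by omega),
      htop _ _ i (by omega) (by omega), htop _ _ i (by omega) (by omega),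
      hhigh _ _ _ (by omega), hhigh _ _ _ (by omega)] at h
    linear_combination h)
  have hall : ∀ a b i, a + b + 2 * i = 2 * j - 1 → C a b i = 0 := by
    intro a b i hab
    by_cases hi : i < j
    · exact hlow a b i hab hi
    · exact hneg a b i (by omega)
  refine ⟨hall, ?_⟩
  have h := hE 0 0 j (by ring)
  rw [leadCoeff, hall (0 - 1) 0 j (by ring), hall 0 (0 - 1) j (by ring),
    hall (0 + 1) 0 (j - 1) (by ring), hall 0 (0 + 1) (j - 1) (by ring), restCoeff,
    hhigh (0 + 1) 0 j (by omega), hhigh 0 (0 + 1) j (by omega),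
    hneg (0 + 1) (0 - 1) j (by omega), hneg (0 - 1) (0 + 1) j (by omega),
    hhigh (0 - 1) 0 (j + 1) (by omega), hhigh 0 (0 - 1) (j + 1) (by omega)] at h
  push_cast at h
  linear_combination h

/-- In weight `2j - 2` only `A u v Z^(j-2)` and a multiple of `Z^(j-1)` can remain, with `A = -2βj c
≠ 0` where `c = C 0 0 j`. The condition for solving in weight `2j - 3` is `(κ - lam) A = 0`. Integer
indices cover `j = 1` too, where `A` has a negative exponent and the hypotheses are contradictory.
-/
theorem eq_of_third_layer {α β κ lam : ℂ} (hβ : β ≠ 0)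
    (hneg : ∀ a b i, a < 0 ∨ b < 0 ∨ i < 0 → C a b i = 0) {j : ℤ} (hj : 1 ≤ j)
    (hE : ∀ a b i, a + b + 2 * i < 2 * j →
      leadCoeff C a b i + restCoeff α β κ lam C a b i = -2 * lam * j * C a b i)
    (hc : C 0 0 j ≠ 0)
    (htop : ∀ a b i, a + b + 2 * i = 2 * j → i ≠ j → C a b i = 0)
    (hsecond : ∀ a b i, a + b + 2 * i = 2 * j - 1 → C a b i = 0) : κ = lam := by
  obtain ⟨hlow, hoff⟩ := even_layers_eq_zero hneg (W := 2 * j - 2) (I := j - 1) (by omega) (by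
    intro a b i hab hi
    have h := hE a b i (by omega)
    rw [hsecond a b i (by omega), restCoeff,
      htop _ _ i (by omega) (by omega), htop _ _ i (by omega) (by omega),
      hsecond a b i (by omega), hsecond _ _ i (by omega), hsecond _ _ i (by omega),
      htop _ _ (i + 1) (by omega) (by omega), htop _ _ (i + 1) (by omega) (by omega)] at h
    linear_combination h)
  have hthird := odd_layers_eq_zero hneg (W := 2 * j - 3) (I := j - 2) ⟨j - 2, by ring⟩ (by
    intro a b i hab hi
    have h := hE a b i (by omega)
    rw [restCoeff, hlow a b i (by omega) (by omega),
      hsecond _ _ i (by omega), hsecond _ _ i (by omega),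
      hlow (a + 1) (b - 1) i (by omega) (by omega),
      hlow (a - 1) (b + 1) i (by omega) (by omega),
      hsecond _ _ (i + 1) (by omega), hsecond _ _ (i + 1) (by omega)] at h
    linear_combination h)
  have e1 : C 1 1 (j - 2) = -2 * β * j * C 0 0 j := by
    have h := hE 1 0 (j - 1) (by omega)
    have h20 : C 2 0 (j - 2) = 0 := hoff _ _ _ (by omega) (by omega) (by omega)
    simp only [leadCoeff, restCoeff] at h
    rw [hneg 1 (0 - 1) (j - 1) (by omega), hneg (1 + 1) (0 - 1) (j - 1) (by omega),
      hneg 1 (0 - 1) (j - 1 + 1) (by omega), hsecond 1 0 (j - 1) (by omega),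
      hsecond (1 - 1) (0 + 1) (j - 1) (by omega),
      htop (1 + 1) 0 (j - 1) (by omega) (by omega),
      htop 1 (0 + 1) (j - 1) (by omega) (by omega),
      show j - 1 - 1 = j - 2 by ring, show j - 1 + 1 = j by ring] at h
    norm_num at h
    rw [h20] at h
    linear_combination h
  have eu := hE 2 0 (j - 2) (by omega)
  have ev := hE 0 2 (j - 2) (by omega)
  have euv := hE 1 1 (j - 2) (by omega)
  have h20 : C 2 0 (j - 2) = 0 := hoff _ _ _ (by omega) (by omega) (by omega)
  have h02 : C 0 2 (j - 2) = 0 := hoff _ _ _ (by omega) (by omega) (by omega)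
  simp only [leadCoeff, restCoeff] at eu ev euv
  rw [hneg 2 (0 - 1) (j - 2) (by omega), hneg (2 + 1) (0 - 1) (j - 2) (by omega),
    hneg 2 (0 - 1) (j - 2 + 1) (by omega), hsecond (2 + 1) 0 (j - 2) (by omega),
    hsecond 2 (0 + 1) (j - 2) (by omega), hsecond (2 - 1) 0 (j - 2 + 1) (by omega),
    hthird _ _ (j - 2 - 1) (by omega) (by omega),
    hthird _ _ (j - 2 - 1) (by omega) (by omega), h20] at eu
  rw [hneg (0 - 1) 2 (j - 2) (by omega), hneg (0 - 1) (2 + 1) (j - 2) (by omega),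
    hneg (0 - 1) 2 (j - 2 + 1) (by omega), hsecond (0 + 1) 2 (j - 2) (by omega),
    hsecond 0 (2 + 1) (j - 2) (by omega), hsecond 0 (2 - 1) (j - 2 + 1) (by omega),
    hthird _ _ (j - 2 - 1) (by omega) (by omega),
    hthird _ _ (j - 2 - 1) (by omega) (by omega), h02] at ev
  rw [hsecond (1 + 1) 1 (j - 2) (by omega), hsecond 1 (1 + 1) (j - 2) (by omega),
    hsecond (1 - 1) 1 (j - 2 + 1) (by omega), hsecond 1 (1 - 1) (j - 2 + 1) (by omega),
    hthird _ _ (j - 2 - 1) (by omega) (by omega),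
    hthird _ _ (j - 2 - 1) (by omega) (by omega)] at euv
  norm_num at eu ev euv
  rw [h20, h02] at euv
  have hA : C 1 1 (j - 2) ≠ 0 := by
    rw [e1]
    have : (j : ℂ) ≠ 0 := intCast_ne_zero' (by omega)
    simp [hβ, hc, this]
  -- Adding the equations at `u²`, `v²` and `uv` cancels the unknown weight `2j - 3` coefficients:
  -- this is evaluation at `u = v`, where the factor `u - v` vanishes.
  have : (κ - lam) * C 1 1 (j - 2) = 0 := by
    linear_combination (-1 / 4 : ℂ) * (euv + eu + ev)
  exact sub_eq_zero.mp ((mul_eq_zero.mp this).resolve_right hA)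

end

/-! ### Coefficients with integer indices -/

/-- The exponent of the monomial `X 0 ^ a * X 1 ^ b * X 2 ^ i`. -/
noncomputable def expo (a b i : ℕ) : Fin 3 →₀ ℕ :=
  Finsupp.single 0 a + Finsupp.single 1 b + Finsupp.single 2 i

theorem expo_apply (m : Fin 3 →₀ ℕ) : expo (m 0) (m 1) (m 2) = m := by
  ext k
  fin_cases k <;> simp [expo]

theorem expo_apply_zero (a b i : ℕ) : expo a b i 0 = a := by simp [expo]

theorem expo_apply_one (a b i : ℕ) : expo a b i 1 = b := by simp [expo]

theorem expo_apply_two (a b i : ℕ) : expo a b i 2 = i := by simp [expo]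

/-- The coefficients of a polynomial in three variables, with integer indices. -/
noncomputable def zcoeff (f : MvPolynomial (Fin 3) ℂ) (a b i : ℤ) : ℂ :=
  if 0 ≤ a ∧ 0 ≤ b ∧ 0 ≤ i then coeff (expo a.toNat b.toNat i.toNat) f else 0

section

variable (f g : MvPolynomial (Fin 3) ℂ) (a b i : ℤ)

theorem zcoeff_neg (h : a < 0 ∨ b < 0 ∨ i < 0) : zcoeff f a b i = 0 := by
  rw [zcoeff, if_neg (by omega)]

theorem zcoeff_natCast (a b i : ℕ) : zcoeff f a b i = coeff (expo a b i) f := by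
  simp [zcoeff]

theorem zcoeff_add : zcoeff (f + g) a b i = zcoeff f a b i + zcoeff g a b i := by
  unfold zcoeff; split_ifs <;> simp

theorem zcoeff_sub : zcoeff (f - g) a b i = zcoeff f a b i - zcoeff g a b i := by
  unfold zcoeff; split_ifs <;> simp

theorem zcoeff_C_mul (c : ℂ) : zcoeff (C c * f) a b i = c * zcoeff f a b i := by
  unfold zcoeff; split_ifs <;> simp

theorem zcoeff_X_mul_zero : zcoeff (X 0 * f) a b i = zcoeff f (a - 1) b i := by
  by_cases h : 0 ≤ a ∧ 0 ≤ b ∧ 0 ≤ i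
  · obtain ⟨ha, hb, hi⟩ := h
    lift a to ℕ using ha; lift b to ℕ using hb; lift i to ℕ using hi
    rw [zcoeff_natCast]
    cases a with
    | zero =>
      rw [coeff_X_mul', if_neg (by simp [expo_apply_zero]), zcoeff_neg _ _ _ _ (by omega)]
    | succ a =>
      rw [show expo (a + 1) b i = expo a b i + Finsupp.single 0 1 by
        ext k; fin_cases k <;> simp [expo], add_comm (expo a b i), coeff_X_mul,
        ← zcoeff_natCast]
      congr 1
      push_cast; ring
  · rw [zcoeff_neg _ _ _ _ (by omega), zcoeff_neg _ _ _ _ (by omega)]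

theorem zcoeff_X_mul_one : zcoeff (X 1 * f) a b i = zcoeff f a (b - 1) i := by
  by_cases h : 0 ≤ a ∧ 0 ≤ b ∧ 0 ≤ i
  · obtain ⟨ha, hb, hi⟩ := h
    lift a to ℕ using ha; lift b to ℕ using hb; lift i to ℕ using hi
    rw [zcoeff_natCast]
    cases b with
    | zero =>
      rw [coeff_X_mul', if_neg (by simp [expo_apply_one]), zcoeff_neg _ _ _ _ (by omega)]
    | succ b =>
      rw [show expo a (b + 1) i = expo a b i + Finsupp.single 1 1 by
        ext k; fin_cases k <;> simp [expo], add_comm (expo a b i), coeff_X_mul,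
        ← zcoeff_natCast]
      congr 1
      push_cast; ring
  · rw [zcoeff_neg _ _ _ _ (by omega), zcoeff_neg _ _ _ _ (by omega)]

theorem zcoeff_X_mul_two : zcoeff (X 2 * f) a b i = zcoeff f a b (i - 1) := by
  by_cases h : 0 ≤ a ∧ 0 ≤ b ∧ 0 ≤ i
  · obtain ⟨ha, hb, hi⟩ := h
    lift a to ℕ using ha; lift b to ℕ using hb; lift i to ℕ using hi
    rw [zcoeff_natCast]
    cases i with
    | zero =>
      rw [coeff_X_mul', if_neg (by simp [expo_apply_two]), zcoeff_neg _ _ _ _ (by omega)]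
    | succ i =>
      rw [show expo a b (i + 1) = expo a b i + Finsupp.single 2 1 by
        ext k; fin_cases k <;> simp [expo], add_comm (expo a b i), coeff_X_mul,
        ← zcoeff_natCast]
      congr 1
      push_cast; ring
  · rw [zcoeff_neg _ _ _ _ (by omega), zcoeff_neg _ _ _ _ (by omega)]

theorem zcoeff_pderiv_zero :
    zcoeff (pderiv 0 f) a b i = (a + 1) * zcoeff f (a + 1) b i := by
  by_cases h : 0 ≤ a ∧ 0 ≤ b ∧ 0 ≤ i
  · obtain ⟨ha, hb, hi⟩ := h
    lift a to ℕ using ha; lift b to ℕ using hb; lift i to ℕ using hi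
    rw [zcoeff_natCast, coeff_pderiv, expo_apply_zero,
      show expo a b i + Finsupp.single 0 1 = expo (a + 1) b i by
        ext k; fin_cases k <;> simp [expo], ← zcoeff_natCast]
    push_cast; ring
  · rw [zcoeff_neg _ _ _ _ (by omega)]
    rcases eq_or_ne a (-1) with rfl | ha
    · simp
    · rw [zcoeff_neg _ _ _ _ (by omega), mul_zero]

theorem zcoeff_pderiv_one :
    zcoeff (pderiv 1 f) a b i = (b + 1) * zcoeff f a (b + 1) i := by
  by_cases h : 0 ≤ a ∧ 0 ≤ b ∧ 0 ≤ i
  · obtain ⟨ha, hb, hi⟩ := h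
    lift a to ℕ using ha; lift b to ℕ using hb; lift i to ℕ using hi
    rw [zcoeff_natCast, coeff_pderiv, expo_apply_one,
      show expo a b i + Finsupp.single 1 1 = expo a (b + 1) i by
        ext k; fin_cases k <;> simp [expo], ← zcoeff_natCast]
    push_cast; ring
  · rw [zcoeff_neg _ _ _ _ (by omega)]
    rcases eq_or_ne b (-1) with rfl | ha
    · simp
    · rw [zcoeff_neg _ _ _ _ (by omega), mul_zero]

theorem zcoeff_pderiv_two :
    zcoeff (pderiv 2 f) a b i = (i + 1) * zcoeff f a b (i + 1) := by
  by_cases h : 0 ≤ a ∧ 0 ≤ b ∧ 0 ≤ i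
  · obtain ⟨ha, hb, hi⟩ := h
    lift a to ℕ using ha; lift b to ℕ using hb; lift i to ℕ using hi
    rw [zcoeff_natCast, coeff_pderiv, expo_apply_two,
      show expo a b i + Finsupp.single 2 1 = expo a b (i + 1) by
        ext k; fin_cases k <;> simp [expo], ← zcoeff_natCast]
    push_cast; ring
  · rw [zcoeff_neg _ _ _ _ (by omega)]
    rcases eq_or_ne i (-1) with rfl | ha
    · simp
    · rw [zcoeff_neg _ _ _ _ (by omega), mul_zero]

end

/-! ### Eigenpolynomials of the normal form -/

/-- A nonzero polynomial has a leading weight, for the weights `1, 1, 2` of the variables. -/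
theorem exists_weight {f : MvPolynomial (Fin 3) ℂ} (hf : f ≠ 0) :
    ∃ n : ℤ, (∃ a b i, a + b + 2 * i = n ∧ zcoeff f a b i ≠ 0) ∧
      ∀ a b i, n < a + b + 2 * i → zcoeff f a b i = 0 := by
  have hbdd : ∀ n : ℤ, (∃ a b i, a + b + 2 * i = n ∧ zcoeff f a b i ≠ 0) →
      n ≤ 2 * f.totalDegree := by
    rintro n ⟨a, b, i, rfl, h⟩
    by_cases hp : 0 ≤ a ∧ 0 ≤ b ∧ 0 ≤ i
    · obtain ⟨ha, hb, hi⟩ := hp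
      lift a to ℕ using ha; lift b to ℕ using hb; lift i to ℕ using hi
      rw [zcoeff_natCast] at h
      have := le_totalDegree (mem_support_iff.mpr h)
      rw [Finsupp.sum_fintype _ _ (fun _ => rfl), Fin.sum_univ_three, expo_apply_zero,
        expo_apply_one, expo_apply_two] at this
      omega
    · exact absurd (zcoeff_neg _ _ _ _ (by omega)) h
  obtain ⟨m, hm⟩ := ne_zero_iff.mp hf
  obtain ⟨n, hn, hmax⟩ := Int.exists_greatest_of_bdd ⟨_, hbdd⟩
    ⟨_, m 0, m 1, m 2, rfl, by rwa [zcoeff_natCast, expo_apply]⟩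
  refine ⟨n, hn, fun a b i h => ?_⟩
  by_contra hne
  exact absurd (hmax _ ⟨a, b, i, rfl, hne⟩) (by omega)

/-- Twice the field of the dynamo, in the coordinates `u = y + s x`, `v = y - s x`,
`Z = 2 s β z` with `s ^ 2 = -α`. -/
noncomputable def modelOp (α β κ lam : ℂ) (f : MvPolynomial (Fin 3) ℂ) :
    MvPolynomial (Fin 3) ℂ :=
  (X 0 * (X 0 - X 1) - X 2 + C (2 * α) - C κ * (X 0 + X 1) - (X 0 - X 1)) * pderiv 0 f
    + (-(X 1 * (X 0 - X 1)) + X 2 + C (2 * α) - C κ * (X 0 + X 1) + (X 0 - X 1)) * pderiv 1 f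
    + (C (2 * β) * (X 0 - X 1) - C (2 * lam) * X 2) * pderiv 2 f

theorem zcoeff_modelOp (α β κ lam : ℂ) (f : MvPolynomial (Fin 3) ℂ) (a b i : ℤ) :
    zcoeff (modelOp α β κ lam f) a b i
      = leadCoeff (zcoeff f) a b i + restCoeff α β κ lam (zcoeff f) a b i := by
  have h : modelOp α β κ lam f = X 0 * (X 0 * pderiv 0 f) - X 0 * (X 1 * pderiv 0 f)
      - X 2 * pderiv 0 f + C (2 * α) * pderiv 0 f - C κ * (X 0 * pderiv 0 f)
      - C κ * (X 1 * pderiv 0 f) - X 0 * pderiv 0 f + X 1 * pderiv 0 f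
      - X 1 * (X 0 * pderiv 1 f) + X 1 * (X 1 * pderiv 1 f)
      + X 2 * pderiv 1 f + C (2 * α) * pderiv 1 f - C κ * (X 0 * pderiv 1 f)
      - C κ * (X 1 * pderiv 1 f) + X 0 * pderiv 1 f - X 1 * pderiv 1 f
      + C (2 * β) * (X 0 * pderiv 2 f) - C (2 * β) * (X 1 * pderiv 2 f)
      - C (2 * lam) * (X 2 * pderiv 2 f) := by
    rw [modelOp]; ring
  rw [h]
  simp only [zcoeff_add, zcoeff_sub, zcoeff_C_mul, zcoeff_X_mul_zero, zcoeff_X_mul_one,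
    zcoeff_X_mul_two, zcoeff_pderiv_zero, zcoeff_pderiv_one, zcoeff_pderiv_two, leadCoeff,
    restCoeff, sub_add_cancel]
  push_cast
  ring

/-- A polynomial of degree at most one is affine. -/
theorem eq_affine_of_totalDegree_le_one {K : MvPolynomial (Fin 3) ℂ} (hK : K.totalDegree ≤ 1) :
    ∃ k₀ p q r : ℂ, K = C k₀ + C p * X 0 + C q * X 1 + C r * X 2 := by
  refine ⟨coeff 0 K, coeff (Finsupp.single 0 1) K, coeff (Finsupp.single 1 1) K,
    coeff (Finsupp.single 2 1) K, ?_⟩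
  ext m
  by_cases hm : 1 < m 0 + m 1 + m 2
  · have hz : coeff m K = 0 := by
      apply coeff_eq_zero_of_totalDegree_lt
      have : ∑ k ∈ m.support, m k = m 0 + m 1 + m 2 := by
        rw [← Fin.sum_univ_three (fun k => m k)]
        exact Finset.sum_subset (Finset.subset_univ _) (by simp)
      omega
    rw [hz]
    simp only [coeff_add, coeff_C_mul, coeff_C, coeff_X]
    rw [if_neg, if_neg, if_neg, if_neg]
    · simp
    all_goals
      intro h
      have h0 := DFunLike.congr_fun h 0
      have h1 := DFunLike.congr_fun h 1
      have h2 := DFunLike.congr_fun h 2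
      simp at h0 h1 h2
      omega
  · have hcases : m = 0 ∨ m = Finsupp.single 0 1 ∨ m = Finsupp.single 1 1 ∨
        m = Finsupp.single 2 1 := by
      rw [← expo_apply m]
      have : (m 0 = 0 ∧ m 1 = 0 ∧ m 2 = 0) ∨ (m 0 = 1 ∧ m 1 = 0 ∧ m 2 = 0) ∨
        (m 0 = 0 ∧ m 1 = 1 ∧ m 2 = 0) ∨ (m 0 = 0 ∧ m 1 = 0 ∧ m 2 = 1) := by omega
      rcases this with ⟨h0, h1, h2⟩ | ⟨h0, h1, h2⟩ | ⟨h0, h1, h2⟩ | ⟨h0, h1, h2⟩ <;>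
        simp [expo, h0, h1, h2]
    rcases hcases with rfl | rfl | rfl | rfl <;>
      simp [coeff_C, coeff_X, Finsupp.single_eq_single_iff,
        eq_comm (a := (0 : Fin 3 →₀ ℕ))]

theorem totalDegree_pderiv_lt {f : MvPolynomial (Fin 3) ℂ} {k : Fin 3} (h : pderiv k f ≠ 0) :
    (pderiv k f).totalDegree < f.totalDegree := by
  have key : ∀ m ∈ (pderiv k f).support, (m.sum fun _ e => e) < f.totalDegree := by
    intro m hm
    rw [mem_support_iff, coeff_pderiv] at hm
    have := le_totalDegree (mem_support_iff.mpr (left_ne_zero_of_mul hm))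
    rw [Finsupp.sum_add_index' (fun _ => rfl) (fun _ _ _ => rfl),
      Finsupp.sum_single_index rfl] at this
    omega
  obtain ⟨m, hm⟩ := ne_zero_iff.mp h
  exact (Finset.sup_lt_iff (by
    have := key m (mem_support_iff.mpr hm)
    rw [bot_eq_zero]; omega)).mpr key

theorem totalDegree_mul_pderiv_le {f q : MvPolynomial (Fin 3) ℂ} (k : Fin 3)
    (hq : q.totalDegree ≤ 2) : (q * pderiv k f).totalDegree ≤ f.totalDegree + 1 := by
  by_cases h : pderiv k f = 0
  · simp [h]
  · have := totalDegree_pderiv_lt h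
    have := totalDegree_mul q (pderiv k f)
    omega

theorem totalDegree_modelOp_le (α β κ lam : ℂ) (f : MvPolynomial (Fin 3) ℂ) :
    (modelOp α β κ lam f).totalDegree ≤ f.totalDegree + 1 := by
  have hadd : ∀ {n : ℕ} {p q : MvPolynomial (Fin 3) ℂ}, p.totalDegree ≤ n → q.totalDegree ≤ n →
      (p + q).totalDegree ≤ n := fun hp hq => (totalDegree_add _ _).trans (max_le hp hq)
  have hsub : ∀ {n : ℕ} {p q : MvPolynomial (Fin 3) ℂ}, p.totalDegree ≤ n → q.totalDegree ≤ n →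
      (p - q).totalDegree ≤ n := fun hp hq => (totalDegree_sub _ _).trans (max_le hp hq)
  have hX : ∀ k : Fin 3, (X k : MvPolynomial (Fin 3) ℂ).totalDegree ≤ 1 := fun k =>
    (totalDegree_X k).le
  have hX2 : ∀ k : Fin 3, (X k : MvPolynomial (Fin 3) ℂ).totalDegree ≤ 2 := fun k =>
    (hX k).trans one_le_two
  have hC : ∀ c : ℂ, (C c : MvPolynomial (Fin 3) ℂ).totalDegree ≤ 2 := fun c => by simp
  have hCm : ∀ (c : ℂ) (p : MvPolynomial (Fin 3) ℂ), p.totalDegree ≤ 1 →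
      (C c * p).totalDegree ≤ 2 := fun c p hp => by
    have := totalDegree_mul (C c) p
    rw [totalDegree_C] at this
    omega
  have hm : ∀ (k : Fin 3) (p : MvPolynomial (Fin 3) ℂ), p.totalDegree ≤ 1 →
      (X k * p).totalDegree ≤ 2 := fun k p hp => by
    have := totalDegree_mul (X k) p
    have := hX k
    omega
  refine hadd (hadd (totalDegree_mul_pderiv_le 0 ?_) (totalDegree_mul_pderiv_le 1 ?_))
    (totalDegree_mul_pderiv_le 2 ?_)
  · exact hsub (hsub (hadd (hsub (hm _ _ (hsub (hX _) (hX _))) (hX2 _)) (hC _))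
      (hCm _ _ (hadd (hX _) (hX _)))) (hsub (hX2 _) (hX2 _))
  · exact hadd (hsub (hadd (hadd ((totalDegree_neg _).le.trans
      (hm _ _ (hsub (hX _) (hX _)))) (hX2 _)) (hC _))
      (hCm _ _ (hadd (hX _) (hX _)))) (hsub (hX2 _) (hX2 _))
  · exact hsub (hCm _ _ (hsub (hX _) (hX _))) (hCm _ _ (hX _))

theorem zcoeff_affine_mul (k₀ p q r : ℂ) (f : MvPolynomial (Fin 3) ℂ) (a b i : ℤ) :
    zcoeff ((C k₀ + C p * X 0 + C q * X 1 + C r * X 2) * f) a b i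
      = k₀ * zcoeff f a b i + p * zcoeff f (a - 1) b i + q * zcoeff f a (b - 1) i
        + r * zcoeff f a b (i - 1) := by
  rw [show (C k₀ + C p * X 0 + C q * X 1 + C r * X 2) * f
    = C k₀ * f + C p * (X 0 * f) + C q * (X 1 * f) + C r * (X 2 * f) by ring]
  simp only [zcoeff_add, zcoeff_C_mul, zcoeff_X_mul_zero, zcoeff_X_mul_one, zcoeff_X_mul_two]

/-- A quadratic field raises the total degree by at most one, and degrees add in products. -/
theorem cofactor_affine {α β κ lam : ℂ} {h K : MvPolynomial (Fin 3) ℂ} (h0 : h ≠ 0)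
    (hK : modelOp α β κ lam h = K * h) :
    ∃ k₀ p q r : ℂ, K = C k₀ + C p * X 0 + C q * X 1 + C r * X 2 := by
  apply eq_affine_of_totalDegree_le_one
  by_cases hK0 : K = 0
  · simp [hK0]
  · have h1 := totalDegree_modelOp_le α β κ lam h
    rw [hK, totalDegree_mul_of_isDomain hK0 h0] at h1
    omega

/-- An eigenpolynomial of the field, up to a polynomial cofactor, is `c Z ^ j` plus terms of lower
weight, its cofactor is the constant `-2 lam j`, and it is constant unless `κ = lam`. -/
theorem darboux_structure {α β κ lam : ℂ} (hβ : β ≠ 0) {h K : MvPolynomial (Fin 3) ℂ}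
    (h0 : h ≠ 0) (hK : modelOp α β κ lam h = K * h) :
    ∃ j : ℕ, K = C (-2 * lam * j) ∧ zcoeff h 0 0 j ≠ 0 ∧
      (∀ a b i : ℤ, 2 * j ≤ a + b + 2 * i → ¬(a = 0 ∧ b = 0 ∧ i = j) → zcoeff h a b i = 0) ∧
      (1 ≤ j → κ = lam) := by
  obtain ⟨k₀, p, q, r, rfl⟩ := cofactor_affine h0 hK
  obtain ⟨n, hn, hhigh⟩ := exists_weight h0
  have hneg : ∀ a b i, a < 0 ∨ b < 0 ∨ i < 0 → zcoeff h a b i = 0 := zcoeff_neg h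
  have hE : ∀ a b i, leadCoeff (zcoeff h) a b i + restCoeff α β κ lam (zcoeff h) a b i
      = k₀ * zcoeff h a b i + p * zcoeff h (a - 1) b i + q * zcoeff h a (b - 1) i
        + r * zcoeff h a b (i - 1) := by
    intro a b i
    rw [← zcoeff_modelOp, hK, zcoeff_affine_mul]
  have hrest : ∀ a b i, n < a + b + 2 * i → restCoeff α β κ lam (zcoeff h) a b i = 0 := by
    intro a b i hw
    rw [restCoeff, hhigh (a + 1) b i (by omega), hhigh a (b + 1) i (by omega),
      hhigh a b i hw, hhigh (a + 1) (b - 1) i (by omega), hhigh (a - 1) (b + 1) i (by omega),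
      hhigh (a - 1) b (i + 1) (by omega), hhigh a (b - 1) (i + 1) (by omega)]
    ring
  -- Multiplication by `Z` raises the weight by two, the field by at most one.
  have hr : r = 0 := by
    obtain ⟨a, b, i, hw, hne⟩ := hn
    have h1 := hE a b (i + 1)
    rw [hrest _ _ _ (by omega), leadCoeff, hhigh (a - 1) b _ (by omega),
      hhigh a (b - 1) _ (by omega), hhigh (a + 1) b _ (by omega), hhigh a (b + 1) _ (by omega),
      hhigh a b (i + 1) (by omega), add_sub_cancel_right] at h1
    have h2 : r * zcoeff h a b i = 0 := by linear_combination -h1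
    exact (mul_eq_zero.mp h2).resolve_right hne
  subst hr
  obtain ⟨rfl, rfl, j, rfl, hc, htop⟩ := top_layer hneg (n := n) (p := p) (q := q) (by
    intro a b i hw
    have h1 := hE a b i
    rw [hrest _ _ _ (by omega), hhigh a b i (by omega)] at h1
    linear_combination h1) hn
  have hj : 0 ≤ j := by
    by_contra hj
    exact hc (hneg _ _ _ (by omega))
  lift j to ℕ using hj
  have hE' : ∀ a b i, leadCoeff (zcoeff h) a b i + restCoeff α β κ lam (zcoeff h) a b i
      = k₀ * zcoeff h a b i := fun a b i => by rw [hE]; ring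
  obtain ⟨hsecond, hk⟩ := second_layer hneg (j := j) (k := k₀) (R := fun _ _ _ => 0)
    (fun a b i _ => by rw [hE', add_zero]) (fun _ _ _ _ _ => rfl) hhigh htop
  have hk' : k₀ = -2 * lam * j := by
    apply mul_right_cancel₀ hc
    push_cast at hk
    linear_combination -hk
  refine ⟨j, by rw [hk']; simp, hc, ?_, ?_⟩
  · intro a b i hw hne
    rcases hw.lt_or_eq with hw | hw
    · exact hhigh a b i hw
    · rcases eq_or_ne i (j : ℤ) with rfl | hi
      · exact hneg a b _ (by omega)
      · exact htop a b i hw.symm hi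
  · intro hj1
    refine eq_of_third_layer (α := α) hβ hneg (j := j) (by exact_mod_cast hj1) ?_ hc htop hsecond
    intro a b i _
    rw [hE', hk']
    push_cast
    ring

theorem eq_C_of_zcoeff {h : MvPolynomial (Fin 3) ℂ}
    (hh : ∀ a b i : ℤ, 0 ≤ a + b + 2 * i → ¬(a = 0 ∧ b = 0 ∧ i = 0) → zcoeff h a b i = 0) :
    h = C (zcoeff h 0 0 0) := by
  ext m
  rw [coeff_C]
  split_ifs with hm
  · subst hm
    have := zcoeff_natCast h 0 0 0
    simpa [expo] using this.symm
  · have := hh (m 0) (m 1) (m 2) (by positivity) (by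
      rintro ⟨h0, h1, h2⟩
      apply hm
      ext k
      fin_cases k <;> simp <;> omega)
    rwa [zcoeff_natCast, expo_apply] at this

theorem modelOp_sub (α β κ lam : ℂ) (f g : MvPolynomial (Fin 3) ℂ) :
    modelOp α β κ lam (f - g) = modelOp α β κ lam f - modelOp α β κ lam g := by
  simp only [modelOp, map_sub]; ring

theorem modelOp_C_mul (α β κ lam c : ℂ) (f : MvPolynomial (Fin 3) ℂ) :
    modelOp α β κ lam (C c * f) = C c * modelOp α β κ lam f := by
  simp only [modelOp, pderiv_C_mul]; ring

/-- The point is the equilibrium `x = z = 0`, `y = α / κ`, where the field vanishes. -/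
theorem eval_modelOp_equilibrium {α β κ lam : ℂ} (hκ : κ ≠ 0) (f : MvPolynomial (Fin 3) ℂ) :
    eval ![α / κ, α / κ, 0] (modelOp α β κ lam f) = 0 := by
  simp only [modelOp, map_add, map_mul, map_sub, map_neg, eval_X, eval_C, Matrix.cons_val]
  field_simp
  ring

/-- The field has no generalized eigenpolynomials beyond the eigenpolynomials, and the eigenspaces
are lines. -/
theorem eq_C_mul_of_modelOp {α β κ lam : ℂ} (hβ : β ≠ 0) (hκ : κ ≠ 0)
    {g h K : MvPolynomial (Fin 3) ℂ} {c₀ : ℂ} (h0 : h ≠ 0) (hh : modelOp α β κ lam h = K * h)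
    (hg : modelOp α β κ lam g = K * g + C c₀ * h) : ∃ c, g = C c * h := by
  obtain ⟨j, rfl, hc, hhw, hj⟩ := darboux_structure hβ h0 hh
  rcases Nat.eq_zero_or_pos j with rfl | hjpos
  · have hhC := eq_C_of_zcoeff (h := h) (by simpa using hhw)
    have hc' : zcoeff h 0 0 0 ≠ 0 := by simpa using hc
    -- For `j = 0`, `h` is constant and the cofactor is zero, so evaluation at the equilibrium
    -- leaves only `c₀ h`.
    have hc₀ : c₀ = 0 := by
      have := eval_modelOp_equilibrium (α := α) (β := β) (lam := lam) hκ g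
      rw [hg, hhC] at this
      simp only [map_add, map_mul, eval_C] at this
      simpa [hc'] using this
    rcases eq_or_ne g 0 with rfl | hg0
    · exact ⟨0, by simp⟩
    · obtain ⟨j', hK, -, hgw, hj'⟩ := darboux_structure hβ hg0
        (hg.trans (by rw [hc₀, C_0, zero_mul, add_zero]))
      have hzero : j' = 0 := by
        by_contra hne
        have hlam := hj' (by omega)
        have := C_injective (Fin 3) ℂ hK
        simp [← hlam, hκ, hne] at this
      subst hzero
      refine ⟨zcoeff g 0 0 0 / zcoeff h 0 0 0, ?_⟩
      calc g = C (zcoeff g 0 0 0) := eq_C_of_zcoeff (by simpa using hgw)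
        _ = C (zcoeff g 0 0 0 / zcoeff h 0 0 0) * C (zcoeff h 0 0 0) := by
          rw [← C_mul, div_mul_cancel₀ _ hc']
        _ = _ := by rw [← hhC]
  · have hκl := hj hjpos
    have hlam : lam ≠ 0 := hκl ▸ hκ
    -- This choice removes `Z^j` from `g - c h`. The difference must vanish, as an eigenpolynomial
    -- for the same eigenvalue has a nonzero coefficient there.
    set c := zcoeff g 0 0 j / zcoeff h 0 0 j with hcdef
    refine ⟨c, ?_⟩
    by_contra hne
    obtain ⟨f, hf⟩ : ∃ f, f = g - C c * h := ⟨_, rfl⟩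
    have hf0 : f ≠ 0 := by rw [hf]; exact sub_ne_zero.mpr hne
    have hfj : zcoeff f 0 0 j = 0 := by
      rw [hf, zcoeff_sub, zcoeff_C_mul, hcdef, div_mul_cancel₀ _ hc, sub_self]
    have hfE : modelOp α β κ lam f = C (-2 * lam * j) * f + C c₀ * h := by
      rw [hf, modelOp_sub, modelOp_C_mul, hg, hh]; ring
    have hE : ∀ a b i, leadCoeff (zcoeff f) a b i + restCoeff α β κ lam (zcoeff f) a b i
        = -2 * lam * j * zcoeff f a b i + c₀ * zcoeff h a b i := by
      intro a b i
      rw [← zcoeff_modelOp, hfE, zcoeff_add, zcoeff_C_mul, zcoeff_C_mul]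
    have hneg : ∀ a b i, a < 0 ∨ b < 0 ∨ i < 0 → zcoeff f a b i = 0 := zcoeff_neg f
    obtain ⟨n, hn, hhigh⟩ := exists_weight hf0
    -- If the weight of `f` is at least `2j`, its top is a multiple of `Z^l` with `l ≠ j`, and the
    -- eigenvalue would have to be both `-2 lam l` and `-2 lam j`. Otherwise the coefficient of
    -- `Z^j` in the equation is just that of `c₀ h`.
    have hc₀ : c₀ = 0 := by
      rcases le_or_gt (2 * (j : ℤ)) n with hjn | hjn
      · exfalso
        obtain ⟨-, -, l, rfl, hl, htop⟩ := top_layer hneg (n := n) (p := 0) (q := 0) (by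
          intro a b i hw
          have h1 := hE a b i
          rw [restCoeff, hhigh (a + 1) b i (by omega), hhigh a (b + 1) i (by omega),
            hhigh a b i (by omega), hhigh (a + 1) (b - 1) i (by omega),
            hhigh (a - 1) (b + 1) i (by omega), hhigh (a - 1) b (i + 1) (by omega),
            hhigh a (b - 1) (i + 1) (by omega), hhw a b i (by omega) (by omega)] at h1
          linear_combination h1) hn
        have hlj : l ≠ j := by rintro rfl; exact hl hfj
        have h1 := (second_layer hneg (j := l) (R := fun _ _ _ => 0) (k := -2 * lam * j) (by
          intro a b i hw
          rw [hE, hhw a b i (by omega) (by omega), mul_zero]) (fun _ _ _ _ _ => rfl)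
          hhigh htop).2
        have h2 : ((l - j : ℤ) : ℂ) * (lam * zcoeff f 0 0 l) = 0 := by
          push_cast
          linear_combination (-1 / 2 : ℂ) * h1
        exact (mul_eq_zero.mp h2).elim (intCast_ne_zero' (by omega)) (mul_ne_zero hlam hl)
      · have h1 := (second_layer hneg (j := j) (R := fun a b i => c₀ * zcoeff h a b i)
          (k := -2 * lam * j) (fun a b i _ => hE a b i)
          (fun a b i hw hi => by
            simp only [hhw a b i (by omega) (by omega), mul_zero])
          (fun a b i hw => hhigh a b i (by omega))
          (fun a b i hw _ => hhigh a b i (by omega))).2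
        rw [hfj] at h1
        simpa [hc] using h1
    rw [hc₀, C_0, zero_mul, add_zero] at hfE
    obtain ⟨j', hK, hj'c, -, -⟩ := darboux_structure hβ hf0 hfE
    have hjj := C_injective (Fin 3) ℂ hK
    have : j = j' := by simpa [hlam] using hjj
    exact hj'c (this ▸ hfj)

/-! ### Return to the original coordinates -/

/-- The linear change of coordinates that takes the dynamo to its normal form. -/
noncomputable def changeVars (s β : ℂ) : MvPolynomial (Fin 3) ℂ →ₐ[ℂ] MvPolynomial (Fin 3) ℂ :=
  aeval ![C (1 / (2 * s)) * (X 0 - X 1), C (1 / 2) * (X 0 + X 1), C (1 / (2 * s * β)) * X 2]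

theorem changeVars_C (s β c : ℂ) : changeVars s β (C c) = C c := by
  simp [changeVars, algebraMap_eq]

theorem changeVars_injective {s β : ℂ} (hs : s ≠ 0) (hβ : β ≠ 0) :
    Function.Injective (changeVars s β) := by
  set ψ : MvPolynomial (Fin 3) ℂ →ₐ[ℂ] MvPolynomial (Fin 3) ℂ :=
    aeval ![X 1 + C s * X 0, X 1 - C s * X 0, C (2 * s * β) * X 2]
  have h : ψ.comp (changeVars s β) = AlgHom.id ℂ _ := by
    apply algHom_ext
    intro k
    apply MvPolynomial.funext
    intro x
    fin_cases k <;> simp [changeVars, ψ, algebraMap_eq] <;> field_simp <;> ring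
  intro f g hfg
  have := congrArg ψ hfg
  rwa [← AlgHom.comp_apply, ← AlgHom.comp_apply, h] at this

theorem fieldOp_add (α β κ lam : ℝ) (f g : MvPolynomial (Fin 3) ℂ) :
    fieldOp α β κ lam (f + g) = fieldOp α β κ lam f + fieldOp α β κ lam g := by
  simp only [fieldOp, map_add]; ring

theorem fieldOp_mul (α β κ lam : ℝ) (f g : MvPolynomial (Fin 3) ℂ) :
    fieldOp α β κ lam (f * g) = fieldOp α β κ lam f * g + f * fieldOp α β κ lam g := by
  simp only [fieldOp, pderiv_mul]; ring

theorem modelOp_add (α β κ lam : ℂ) (f g : MvPolynomial (Fin 3) ℂ) :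
    modelOp α β κ lam (f + g) = modelOp α β κ lam f + modelOp α β κ lam g := by
  simp only [modelOp, map_add]; ring

theorem modelOp_mul (α β κ lam : ℂ) (f g : MvPolynomial (Fin 3) ℂ) :
    modelOp α β κ lam (f * g) = modelOp α β κ lam f * g + f * modelOp α β κ lam g := by
  simp only [modelOp, pderiv_mul]; ring

theorem modelOp_changeVars {α β κ lam : ℝ} {s : ℂ} (hs0 : s ≠ 0) (hs : s ^ 2 = -α) (hβ : β ≠ 0)
    (f : MvPolynomial (Fin 3) ℂ) :
    modelOp α β κ lam (changeVars s β f) = C 2 * changeVars s β (fieldOp α β κ lam f) := by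
  have hβ' : (β : ℂ) ≠ 0 := by exact_mod_cast hβ
  have hα : (α : ℂ) = -s ^ 2 := by rw [hs, neg_neg]
  induction f using MvPolynomial.induction_on with
  | C a => rw [changeVars_C]; simp [modelOp, fieldOp]
  | add f g hf hg => rw [map_add, modelOp_add, hf, hg, fieldOp_add, map_add, mul_add]
  | mul_X f k hf =>
    have hX : modelOp α β κ lam (changeVars s β (X k))
        = C 2 * changeVars s β (fieldOp α β κ lam (X k)) := by
      apply MvPolynomial.funext
      intro x
      fin_cases k
      · simp [changeVars, modelOp, fieldOp, algebraMap_eq, pderiv_X, Derivation.leibniz, hα]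
        field_simp
        ring
      · simp [changeVars, modelOp, fieldOp, algebraMap_eq, pderiv_X, Derivation.leibniz, hα]
        field_simp
        ring
      · simp [changeVars, modelOp, fieldOp, algebraMap_eq, pderiv_X, Derivation.leibniz, hα]
        field_simp
    rw [map_mul, modelOp_mul, hf, hX, fieldOp_mul, map_add, map_mul, map_mul]
    ring

theorem exists_sq_eq_neg {α : ℝ} (hα : α ≠ 0) : ∃ s : ℂ, s ≠ 0 ∧ s ^ 2 = -α := by
  obtain ⟨s, hs⟩ := IsAlgClosed.exists_pow_nat_eq (-α : ℂ) (n := 2) (by norm_num)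
  refine ⟨s, ?_, hs⟩
  rintro rfl
  apply hα
  have : (α : ℂ) = 0 := by simpa using hs.symm
  exact_mod_cast this

theorem fieldOp_cofactor {α β κ lam : ℝ} (hα : α ≠ 0) (hβ : β ≠ 0)
    {h K : MvPolynomial (Fin 3) ℂ} (h0 : h ≠ 0) (hK : fieldOp α β κ lam h = K * h) :
    ∃ j : ℕ, K = C (-lam * j : ℂ) ∧ (1 ≤ j → κ = lam) ∧ (j = 0 → ∃ c, h = C c) := by
  obtain ⟨s, hs0, hs⟩ := exists_sq_eq_neg hα
  have hβ' : (β : ℂ) ≠ 0 := by exact_mod_cast hβ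
  have hinj := changeVars_injective hs0 hβ'
  have hmodel : modelOp α β κ lam (changeVars s β h)
      = (C 2 * changeVars s β K) * changeVars s β h := by
    rw [modelOp_changeVars hs0 hs hβ, hK, map_mul, mul_assoc]
  obtain ⟨j, hj, -, hw, hκ⟩ := darboux_structure hβ'
    ((map_ne_zero_iff _ hinj).mpr h0) hmodel
  refine ⟨j, ?_, fun h1 => by exact_mod_cast hκ h1, ?_⟩
  · apply hinj
    have h2 : (C 2 : MvPolynomial (Fin 3) ℂ) ≠ 0 := by
      rw [Ne, C_eq_zero]; norm_num
    apply mul_left_cancel₀ h2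
    rw [hj, changeVars_C, ← C_mul]
    congr 1
    ring
  · rintro rfl
    have := eq_C_of_zcoeff (h := changeVars s β h) (by simpa using hw)
    rw [← changeVars_C s β] at this
    exact ⟨_, hinj this⟩

theorem eq_C_mul_of_fieldOp {α β κ lam : ℝ} (hα : α ≠ 0) (hβ : β ≠ 0) (hκ : κ ≠ 0)
    {g h K : MvPolynomial (Fin 3) ℂ} {c₀ : ℂ} (h0 : h ≠ 0) (hh : fieldOp α β κ lam h = K * h)
    (hg : fieldOp α β κ lam g = K * g + C c₀ * h) : ∃ c, g = C c * h := by
  obtain ⟨s, hs0, hs⟩ := exists_sq_eq_neg hα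
  have hβ' : (β : ℂ) ≠ 0 := by exact_mod_cast hβ
  have hκ' : (κ : ℂ) ≠ 0 := by exact_mod_cast hκ
  have hinj := changeVars_injective hs0 hβ'
  obtain ⟨c, hc⟩ := eq_C_mul_of_modelOp (α := α) (lam := lam) hβ' hκ'
    (g := changeVars s β g) (h := changeVars s β h) (K := C 2 * changeVars s β K)
    (c₀ := 2 * c₀) ((map_ne_zero_iff _ hinj).mpr h0)
    (by rw [modelOp_changeVars hs0 hs hβ, hh, map_mul, mul_assoc])
    (by rw [modelOp_changeVars hs0 hs hβ, hg, map_add, map_mul, map_mul, changeVars_C, C_mul]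
        ring)
  refine ⟨c, hinj ?_⟩
  rw [hc, map_mul, changeVars_C]

/-- A rational function with constant derivative along the field is constant. -/
theorem eq_C_mul_of_fieldOp_div {α β κ lam : ℝ} (hα : α ≠ 0) (hβ : β ≠ 0) (hκ : κ ≠ 0)
    {g h : MvPolynomial (Fin 3) ℂ} {c₀ : ℂ} (h0 : h ≠ 0)
    (hgh : fieldOp α β κ lam g * h - g * fieldOp α β κ lam h = C c₀ * h ^ 2) :
    ∃ c, g = C c * h := by
  obtain ⟨h', g', d, hrel, rfl, rfl⟩ := UniqueFactorizationMonoid.exists_reduced_factors h h0 g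
  have hd : d ≠ 0 := left_ne_zero_of_mul h0
  have h0' : h' ≠ 0 := right_ne_zero_of_mul h0
  have hred : fieldOp α β κ lam g' * h' - g' * fieldOp α β κ lam h' = C c₀ * h' ^ 2 := by
    apply mul_left_cancel₀ (pow_ne_zero 2 hd)
    rw [fieldOp_mul, fieldOp_mul] at hgh
    linear_combination hgh
  -- For a reduced fraction the denominator divides its own derivative, so it has a cofactor, and
  -- the numerator is a generalized eigenvector over it.
  have hdvd : h' ∣ fieldOp α β κ lam h' := by
    apply hrel.dvd_of_dvd_mul_left
    exact ⟨fieldOp α β κ lam g' - C c₀ * h', by linear_combination -hred⟩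
  obtain ⟨K, hK⟩ := hdvd
  obtain ⟨c, hc⟩ := eq_C_mul_of_fieldOp (c₀ := c₀) (g := g') hα hβ hκ h0'
    (hK.trans (mul_comm _ _)) (by
      apply mul_left_cancel₀ h0'
      rw [hK] at hred
      linear_combination hred)
  exact ⟨c, by rw [hc]; ring⟩

/-! ### Polynomials at real points, solution curves, and constancy -/

theorem continuous_evalAt (p : MvPolynomial (Fin 3) ℂ) : Continuous (evalAt p) := by
  unfold evalAt
  exact p.continuous_eval.comp
    (continuous_pi fun i => Complex.continuous_ofReal.comp (continuous_apply i))

theorem evalAt_add (p q : MvPolynomial (Fin 3) ℂ) (v : Fin 3 → ℝ) :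
    evalAt (p + q) v = evalAt p v + evalAt q v := by simp [evalAt]

theorem evalAt_sub (p q : MvPolynomial (Fin 3) ℂ) (v : Fin 3 → ℝ) :
    evalAt (p - q) v = evalAt p v - evalAt q v := by simp [evalAt]

theorem evalAt_mul (p q : MvPolynomial (Fin 3) ℂ) (v : Fin 3 → ℝ) :
    evalAt (p * q) v = evalAt p v * evalAt q v := by simp [evalAt]

theorem evalAt_pow (p : MvPolynomial (Fin 3) ℂ) (n : ℕ) (v : Fin 3 → ℝ) :
    evalAt (p ^ n) v = evalAt p v ^ n := by simp [evalAt]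

theorem evalAt_C (c : ℂ) (v : Fin 3 → ℝ) : evalAt (C c) v = c := by simp [evalAt]

theorem evalAt_one (v : Fin 3 → ℝ) : evalAt 1 v = 1 := by simp [evalAt]

/-- A polynomial that vanishes on a nonempty open set of real points is zero. -/
theorem eq_zero_of_evalAt_eq_zero {p : MvPolynomial (Fin 3) ℂ} {W : Set (Fin 3 → ℝ)}
    (hW : IsOpen W) (hne : W.Nonempty) (h : ∀ v ∈ W, evalAt p v = 0) : p = 0 := by
  obtain ⟨v, hv⟩ := hne
  obtain ⟨ε, hε, hball⟩ := Metric.isOpen_iff.mp hW v hv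
  apply funext_set (fun i => Complex.ofReal '' Set.Ioo (v i - ε) (v i + ε))
  · intro i
    exact (Set.Ioo_infinite (by linarith)).image Complex.ofReal_injective.injOn
  · intro x hx
    choose w hw hwx using fun i => hx i (Set.mem_univ i)
    have hwW : w ∈ W := by
      apply hball
      rw [Metric.mem_ball, dist_pi_lt_iff hε]
      intro i
      rw [Real.dist_eq, abs_lt]
      constructor <;> linarith [(hw i).1, (hw i).2]
    have := h w hwW
    rw [evalAt] at this
    simpa [show x = fun i => (w i : ℂ) from (funext hwx).symm] using this

theorem exists_evalAt_ne_zero {p : MvPolynomial (Fin 3) ℂ} (hp : p ≠ 0) {W : Set (Fin 3 → ℝ)}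
    (hW : IsOpen W) (hne : W.Nonempty) : ∃ v ∈ W, evalAt p v ≠ 0 := by
  by_contra! h
  exact hp (eq_zero_of_evalAt_eq_zero hW hne h)

theorem isOpen_evalAt_ne_zero (p : MvPolynomial (Fin 3) ℂ) : IsOpen {v | evalAt p v ≠ 0} :=
  isOpen_ne.preimage (continuous_evalAt p)

/-- The derivative of a polynomial at the point `v` in the direction `w`. -/
noncomputable def dirDeriv (v w : Fin 3 → ℝ) (p : MvPolynomial (Fin 3) ℂ) : ℂ :=
  ∑ i, (w i : ℂ) * evalAt (pderiv i p) v

theorem dirDeriv_add (v w : Fin 3 → ℝ) (p q : MvPolynomial (Fin 3) ℂ) :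
    dirDeriv v w (p + q) = dirDeriv v w p + dirDeriv v w q := by
  simp only [dirDeriv, map_add, evalAt_add, mul_add, Finset.sum_add_distrib]

theorem dirDeriv_mul (v w : Fin 3 → ℝ) (p q : MvPolynomial (Fin 3) ℂ) :
    dirDeriv v w (p * q) = dirDeriv v w p * evalAt q v + evalAt p v * dirDeriv v w q := by
  simp only [dirDeriv, pderiv_mul, evalAt_add, evalAt_mul, mul_add, Finset.sum_add_distrib,
    Finset.sum_mul, Finset.mul_sum]
  congr 1 <;> exact Finset.sum_congr rfl fun i _ => by ring

theorem dirDeriv_C (v w : Fin 3 → ℝ) (c : ℂ) : dirDeriv v w (C c) = 0 := by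
  simp [dirDeriv, evalAt]

theorem dirDeriv_X (v w : Fin 3 → ℝ) (k : Fin 3) : dirDeriv v w (X k) = w k := by
  rw [dirDeriv, Finset.sum_eq_single k]
  · simp [evalAt]
  · intro i _ hi
    rw [pderiv_X_of_ne hi.symm]; simp [evalAt]
  · simp

theorem hasDerivAt_evalAt {γ : ℝ → Fin 3 → ℝ} {γ' : Fin 3 → ℝ} {t : ℝ} (hγ : HasDerivAt γ γ' t)
    (p : MvPolynomial (Fin 3) ℂ) :
    HasDerivAt (fun τ => evalAt p (γ τ)) (dirDeriv (γ t) γ' p) t := by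
  induction p using MvPolynomial.induction_on with
  | C a => simpa [evalAt, dirDeriv_C] using hasDerivAt_const t a
  | add p q hp hq =>
    refine ((hp.add hq).congr_deriv (dirDeriv_add _ _ _ _).symm).congr_of_eventuallyEq
      (.of_forall fun τ => evalAt_add _ _ _)
  | mul_X p k hp =>
    have hX : ∀ τ, evalAt (X k) (γ τ) = ((γ τ k : ℝ) : ℂ) := fun τ => by simp [evalAt]
    have hk : HasDerivAt (fun τ => ((γ τ k : ℝ) : ℂ)) (γ' k : ℂ) t :=
      ((hasDerivAt_pi.mp hγ) k).ofReal_comp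
    refine ((hp.mul hk).congr_deriv ?_).congr_of_eventuallyEq (.of_forall fun τ => ?_)
    · rw [dirDeriv_mul, dirDeriv_X, hX]
    · exact (evalAt_mul _ _ _).trans (by rw [hX]; rfl)

theorem evalAt_fieldOp (α β κ lam : ℝ) (p : MvPolynomial (Fin 3) ℂ) (v : Fin 3 → ℝ) :
    evalAt (fieldOp α β κ lam p) v = dirDeriv v (vectorField α β κ lam v) p := by
  simp [evalAt, fieldOp, dirDeriv, vectorField, Fin.sum_univ_three]

/-- Through every point of an open set passes a solution that stays in the set for some time. -/
theorem exists_solution (α β κ lam : ℝ) {U : Set (Fin 3 → ℝ)} (hU : IsOpen U)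
    {v : Fin 3 → ℝ} (hv : v ∈ U) :
    ∃ ε > 0, ∃ γ : ℝ → Fin 3 → ℝ, γ 0 = v ∧ IsSolutionOn α β κ lam (-ε) ε γ ∧
      ∀ t ∈ Set.Ioo (-ε) ε, γ t ∈ U := by
  have hsmooth : ContDiff ℝ 1 (vectorField α β κ lam) := by
    rw [contDiff_pi]
    intro i
    fin_cases i <;> simp [vectorField] <;> fun_prop
  obtain ⟨γ, h0, ε, hε, hγ⟩ :=
    hsmooth.contDiffAt.exists_forall_mem_closedBall_exists_eq_forall_mem_Ioo_hasDerivAt₀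
      (x₀ := v) 0
  have hcont : ContinuousAt γ 0 := (hγ 0 (by constructor <;> linarith)).continuousAt
  obtain ⟨δ, hδ, hball⟩ := Metric.mem_nhds_iff.mp (hcont (hU.mem_nhds (h0 ▸ hv)))
  refine ⟨min ε δ, lt_min hε hδ, γ, h0, ?_, ?_⟩
  · intro t ht
    apply hγ
    constructor
    · linarith [ht.1, min_le_left ε δ]
    · linarith [ht.2, min_le_left ε δ]
  · intro t ht
    apply hball
    rw [Metric.mem_ball, Real.dist_eq, sub_zero, abs_lt]
    constructor
    · linarith [ht.1, min_le_right ε δ]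
    · linarith [ht.2, min_le_right ε δ]

/-- A first integral has derivative zero along the solutions. -/
theorem IsFirstIntegralOn.exists_curve {α β κ lam : ℝ} {U : Set (Fin 3 → ℝ)}
    {H : (Fin 3 → ℝ) → ℂ} (hH : IsFirstIntegralOn α β κ lam U H) {v : Fin 3 → ℝ} (hv : v ∈ U) :
    ∃ γ : ℝ → Fin 3 → ℝ, γ 0 = v ∧ HasDerivAt γ (vectorField α β κ lam v) 0 ∧
      HasDerivAt (fun t => H (γ t)) 0 0 := by
  obtain ⟨ε, hε, γ, h0, hsol, hU⟩ := exists_solution α β κ lam hH.isOpen hv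
  have hmem : (0 : ℝ) ∈ Set.Ioo (-ε) ε := by constructor <;> linarith
  refine ⟨γ, h0, h0 ▸ hsol 0 hmem, ?_⟩
  apply (hasDerivAt_const (0 : ℝ) (H v)).congr_of_eventuallyEq
  filter_upwards [Ioo_mem_nhds hmem.1 hmem.2] with t ht
  rw [hH.constant_along _ _ γ hsol hU t ht 0 hmem, h0]

/-- A continuous logarithm of a differentiable function is differentiable. -/
theorem hasDerivAt_of_exp_eq {l F : ℝ → ℂ} {F' : ℂ} {t : ℝ} (hl : ContinuousAt l t)
    (he : ∀ᶠ τ in 𝓝 t, Complex.exp (l τ) = F τ) (hF : HasDerivAt F F' t) :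
    HasDerivAt l (F' / F t) t := by
  have ht : Complex.exp (l t) = F t := he.self_of_nhds
  have hFt : F t ≠ 0 := ht ▸ Complex.exp_ne_zero _
  -- The quotient is near 1, where the principal logarithm is smooth; by continuity of `l` this is
  -- the same branch.
  have hlog : HasDerivAt (fun τ => l t + Complex.log (F τ / F t)) (F' / F t) t := by
    have h1 : HasDerivAt (fun τ => F τ / F t) (F' / F t) t := hF.div_const _
    have h2 := h1.clog_real (by rw [div_self hFt]; exact Complex.one_mem_slitPlane)
    rw [div_self hFt, div_one] at h2
    exact h2.const_add _
  apply hlog.congr_of_eventuallyEq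
  have him : ContinuousAt (fun τ => (l τ - l t).im) t :=
    Complex.continuous_im.continuousAt.comp (hl.sub continuousAt_const)
  have hsmall : ∀ᶠ τ in 𝓝 t, (l τ - l t).im ∈ Set.Ioo (-Real.pi) Real.pi :=
    him.eventually_mem (Ioo_mem_nhds (by simp [Real.pi_pos]) (by simp [Real.pi_pos]))
  filter_upwards [he, hsmall] with τ hτ hs
  rw [← hτ, ← ht, ← Complex.exp_sub, Complex.log_exp hs.1 hs.2.le]
  ring

/-- The zeros of a nonzero polynomial on a line that is not contained in its zero set. -/
theorem finite_zeros_on_line {Q : MvPolynomial (Fin 3) ℂ} {v w : Fin 3 → ℝ}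
    (hw : evalAt Q w ≠ 0) : {t : ℝ | evalAt Q (v + t • (w - v)) = 0}.Finite := by
  set P : Polynomial ℂ := aeval (fun i => Polynomial.C (v i : ℂ)
    + Polynomial.X * Polynomial.C ((w i - v i : ℝ) : ℂ)) Q with hPdef
  have hP : ∀ t : ℝ, P.eval (t : ℂ) = evalAt Q (v + t • (w - v)) := by
    intro t
    rw [hPdef, evalAt, ← Polynomial.coe_evalRingHom, aeval_def, hom_eval₂, eval]
    congr 1
    · ext c; simp
    · funext i; simp
  have hP0 : P ≠ 0 := by
    intro h
    have := hP 1
    rw [h, Polynomial.eval_zero, one_smul, add_sub_cancel] at this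
    exact hw this.symm
  refine ((P.roots.toFinset.finite_toSet).preimage Complex.ofReal_injective.injOn).subset ?_
  intro t ht
  simp only [Set.mem_ofPred_eq] at ht
  simp [hP0, hP, ht]

/-- A continuous function on a connected open set is constant if it has derivative zero outside of
the zero set of a polynomial. -/
theorem eq_of_hasDerivAt_zero {U : Set (Fin 3 → ℝ)} {G : (Fin 3 → ℝ) → ℂ} (hU : IsOpen U)
    (hconn : IsConnected U) (hG : ContinuousOn G U) {Q : MvPolynomial (Fin 3) ℂ} (hQ : Q ≠ 0)
    (hd : ∀ (γ : ℝ → Fin 3 → ℝ) (γ' : Fin 3 → ℝ) (t : ℝ), HasDerivAt γ γ' t → γ t ∈ U →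
      evalAt Q (γ t) ≠ 0 → HasDerivAt (fun τ => G (γ τ)) 0 t) :
    ∀ v ∈ U, ∀ w ∈ U, G v = G w := by
  have hloc : ∀ v ∈ U, ∃ ε > 0, Metric.ball v ε ⊆ U ∧ ∀ x ∈ Metric.ball v ε, G x = G v := by
    intro v hv
    obtain ⟨ε, hε, hball⟩ := Metric.isOpen_iff.mp hU v hv
    refine ⟨ε, hε, hball, ?_⟩
    -- Every segment from a point of the ball to `w` meets the zero set finitely often, so the
    -- fundamental theorem of calculus with a countable exceptional set applies.
    obtain ⟨w, hw, hwQ⟩ := exists_evalAt_ne_zero hQ Metric.isOpen_ball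
      ⟨v, Metric.mem_ball_self hε⟩
    have key : ∀ x ∈ Metric.ball v ε, G x = G w := by
      intro x hx
      have hseg : ∀ t ∈ Set.Icc (0 : ℝ) 1, x + t • (w - x) ∈ Metric.ball v ε := by
        intro t ht
        exact (convex_ball v ε).add_smul_sub_mem hx hw ht
      have hcont : Continuous fun t : ℝ => x + t • (w - x) := by fun_prop
      have := MeasureTheory.integral_eq_of_hasDerivAt_off_countable
        (fun t : ℝ => G (x + t • (w - x))) (fun _ => 0) (a := 0) (b := 1)
        (finite_zeros_on_line (v := x) hwQ).countable ?_ ?_ (by simp)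
      · simp only [intervalIntegral.integral_zero, one_smul, zero_smul, add_zero,
          add_sub_cancel] at this
        exact (sub_eq_zero.mp this.symm).symm
      · rw [Set.uIcc_of_le zero_le_one]
        exact hG.comp hcont.continuousOn fun t ht => hball (hseg t ht)
      · intro t ht
        rw [min_eq_left zero_le_one, max_eq_right zero_le_one] at ht
        refine hd (fun t => x + t • (w - x)) (w - x) t ?_
          (hball (hseg t (Set.Ioo_subset_Icc_self ht.1))) ht.2
        simpa using ((hasDerivAt_id t).smul_const (w - x)).const_add x
    intro x hx
    rw [key x hx, key v (Metric.mem_ball_self hε)]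
  intro v hv w hw
  have hopen : ∀ P : ℂ → Prop, IsOpen {x | x ∈ U ∧ P (G x)} := by
    intro P
    rw [Metric.isOpen_iff]
    rintro x ⟨hx, hPx⟩
    obtain ⟨ε, hε, hball, hc⟩ := hloc x hx
    exact ⟨ε, hε, fun y hy => ⟨hball hy, by rwa [hc y hy]⟩⟩
  have := hconn.isPreconnected.subset_left_of_subset_union (hopen (· = G v)) (hopen (· ≠ G v))
    (by rw [Set.disjoint_left]; rintro x ⟨_, h1⟩ ⟨_, h2⟩; exact h2 h1)
    (fun x hx => (em (G x = G v)).imp (fun h => ⟨hx, h⟩) (fun h => ⟨hx, h⟩))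
    ⟨v, hv, hv, rfl⟩
  exact ((this hw).2).symm

theorem hasDerivAt_div {γ : ℝ → Fin 3 → ℝ} {γ' : Fin 3 → ℝ} {t : ℝ} (hγ : HasDerivAt γ γ' t)
    (p : MvPolynomial (Fin 3) ℂ) {q : MvPolynomial (Fin 3) ℂ} (hq : evalAt q (γ t) ≠ 0) :
    HasDerivAt (fun τ => evalAt p (γ τ) / evalAt q (γ τ))
      ((dirDeriv (γ t) γ' p * evalAt q (γ t) - evalAt p (γ t) * dirDeriv (γ t) γ' q)
        / evalAt q (γ t) ^ 2) t :=
  (hasDerivAt_evalAt hγ p).div (hasDerivAt_evalAt hγ q) hq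

/-! ### Nonexistence of first integrals -/

theorem not_hasRationalFirstIntegral {α β κ lam : ℝ} (hα : α ≠ 0) (hβ : β ≠ 0) (hκ : κ ≠ 0) :
    ¬ HasRationalFirstIntegral α β κ lam := by
  rintro ⟨U, H, p, q, hq, hH, hform⟩
  obtain ⟨v₀, hv₀, hv₀q⟩ := exists_evalAt_ne_zero hq hH.isOpen hH.isConnected.nonempty
  have hWopen : IsOpen (U ∩ {v | evalAt q v ≠ 0}) := hH.isOpen.inter (isOpen_evalAt_ne_zero q)
  have hnear : ∀ (γ : ℝ → Fin 3 → ℝ) (t : ℝ), ContinuousAt γ t → γ t ∈ U →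
      evalAt q (γ t) ≠ 0 →
      ∀ᶠ τ in 𝓝 t, evalAt q (γ τ) ≠ 0 ∧ H (γ τ) = evalAt p (γ τ) / evalAt q (γ τ) := by
    intro γ t hγ hU hne
    filter_upwards [hγ (hWopen.mem_nhds ⟨hU, hne⟩)] with τ hτ
    exact ⟨hτ.2, hform _ hτ.1 hτ.2⟩
  have hident : fieldOp α β κ lam p * q - p * fieldOp α β κ lam q = 0 := by
    refine eq_zero_of_evalAt_eq_zero hWopen ⟨v₀, hv₀, hv₀q⟩ ?_
    rintro v ⟨hvU, hvq⟩
    obtain ⟨γ, rfl, hγ, hγH⟩ := hH.exists_curve hvU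
    have h1 := (hasDerivAt_div hγ p hvq).congr_of_eventuallyEq
      ((hnear γ 0 hγ.continuousAt hvU hvq).mono fun τ hτ => hτ.2)
    have h2 := h1.unique hγH
    rw [div_eq_zero_iff, or_iff_left (pow_ne_zero 2 hvq)] at h2
    rw [evalAt_sub, evalAt_mul, evalAt_mul, evalAt_fieldOp, evalAt_fieldOp, h2]
  obtain ⟨c, rfl⟩ := eq_C_mul_of_fieldOp_div (c₀ := 0) hα hβ hκ hq (by rw [hident]; simp)
  obtain ⟨v, hv, w, hw, hne⟩ := hH.nonconstant
  refine hne (eq_of_hasDerivAt_zero hH.isOpen hH.isConnected hH.continuousOn hq ?_ v hv w hw)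
  intro γ γ' t hγ hU hneq
  apply (hasDerivAt_const t c).congr_of_eventuallyEq
  filter_upwards [hnear γ t hγ.continuousAt hU hneq] with τ hτ
  rw [hτ.2, evalAt_mul, evalAt_C, mul_div_cancel_right₀ _ hτ.1]

theorem not_hasPolynomialFirstIntegral {α β κ lam : ℝ} (hα : α ≠ 0) (hβ : β ≠ 0)
    (hκ : κ ≠ 0) : ¬ HasPolynomialFirstIntegral α β κ lam := by
  rintro ⟨U, p, hp⟩
  exact not_hasRationalFirstIntegral hα hβ hκ
    ⟨U, evalAt p, p, 1, one_ne_zero, hp, fun v _ _ => by rw [evalAt_one, div_one]⟩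

theorem exists_common_denominator {q : ℕ} (g h : Fin q → MvPolynomial (Fin 3) ℂ) (m : Fin q → ℂ)
    (hh : ∀ k, h k ≠ 0) :
    ∃ G H : MvPolynomial (Fin 3) ℂ, H ≠ 0 ∧ ∀ v, evalAt H v ≠ 0 →
      (∀ k, evalAt (h k) v ≠ 0) ∧
        ∑ k, m k * (evalAt (g k) v / evalAt (h k) v) = evalAt G v / evalAt H v := by
  induction q with
  | zero => exact ⟨0, 1, one_ne_zero, fun v _ => ⟨fun k => k.elim0, by simp [evalAt]⟩⟩
  | succ q ih =>
    obtain ⟨G, H, hH, hGH⟩ := ih (fun k => g k.succ) (fun k => h k.succ) (fun k => m k.succ)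
      (fun k => hh _)
    refine ⟨C (m 0) * g 0 * H + G * h 0, h 0 * H, mul_ne_zero (hh 0) hH, fun v hv => ?_⟩
    rw [evalAt_mul] at hv
    have h0 := left_ne_zero_of_mul hv
    have h1 := right_ne_zero_of_mul hv
    obtain ⟨h2, h3⟩ := hGH v h1
    refine ⟨Fin.cases h0 h2, ?_⟩
    rw [Fin.sum_univ_succ, h3, evalAt_add, evalAt_mul, evalAt_mul, evalAt_mul, evalAt_mul,
      evalAt_C]
    field_simp

theorem fieldOp_pow {α β κ lam : ℝ} {f : MvPolynomial (Fin 3) ℂ} {k : ℂ}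
    (hf : fieldOp α β κ lam f = C k * f) (n : ℕ) :
    fieldOp α β κ lam (f ^ n) = C (n * k) * f ^ n := by
  induction n with
  | zero => simp [fieldOp]
  | succ n ih =>
    rw [pow_succ, fieldOp_mul, ih, hf]
    simp only [Nat.cast_succ, add_mul, one_mul, C_add]
    ring

theorem dirDeriv_pow (v w : Fin 3 → ℝ) (f : MvPolynomial (Fin 3) ℂ) (n : ℕ) :
    dirDeriv v w (f ^ n) * evalAt f v = n * evalAt f v ^ n * dirDeriv v w f := by
  induction n with
  | zero =>
    have := dirDeriv_C v w 1
    rw [C_1] at this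
    simp [this]
  | succ n ih =>
    rw [pow_succ, dirDeriv_mul, evalAt_pow]
    push_cast
    linear_combination evalAt f v * ih

/-- Any two Darboux polynomials have proportional logarithmic derivatives. -/
theorem dirDeriv_div_eq {α β κ lam : ℝ} (hα : α ≠ 0) (hβ : β ≠ 0) (hκ : κ ≠ 0)
    {f₁ f₂ : MvPolynomial (Fin 3) ℂ} {a₁ a₂ : ℕ} (h₂ : f₂ ≠ 0)
    (hf₁ : fieldOp α β κ lam f₁ = C (-lam * a₁ : ℂ) * f₁)
    (hf₂ : fieldOp α β κ lam f₂ = C (-lam * a₂ : ℂ) * f₂) {v : Fin 3 → ℝ} (w : Fin 3 → ℝ)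
    (hv₁ : evalAt f₁ v ≠ 0) (hv₂ : evalAt f₂ v ≠ 0) :
    a₂ * (dirDeriv v w f₁ / evalAt f₁ v) = a₁ * (dirDeriv v w f₂ / evalAt f₂ v) := by
  obtain ⟨c, hc⟩ := eq_C_mul_of_fieldOp (c₀ := 0) (g := f₁ ^ a₂) hα hβ hκ
    (pow_ne_zero a₁ h₂) (fieldOp_pow hf₂ a₁) (by
      rw [fieldOp_pow hf₁ a₂, C_0, zero_mul, add_zero]
      congr 2
      ring)
  have hval : evalAt f₁ v ^ a₂ = c * evalAt f₂ v ^ a₁ := by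
    rw [← evalAt_pow, hc, evalAt_mul, evalAt_C, evalAt_pow]
  have hder : dirDeriv v w (f₁ ^ a₂) = c * dirDeriv v w (f₂ ^ a₁) := by
    rw [hc, dirDeriv_mul, dirDeriv_C, evalAt_C]; ring
  have h1 := dirDeriv_pow v w f₁ a₂
  have h2 := dirDeriv_pow v w f₂ a₁
  have key : (a₂ : ℂ) * dirDeriv v w f₁ * evalAt f₂ v = a₁ * dirDeriv v w f₂ * evalAt f₁ v := by
    apply mul_left_cancel₀ (pow_ne_zero a₂ hv₁)
    rw [hder] at h1
    linear_combination (-evalAt f₂ v) * h1 + c * evalAt f₁ v * h2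
      - a₁ * dirDeriv v w f₂ * evalAt f₁ v * hval
  field_simp
  linear_combination key

/-- The logarithmic derivative of a function of Darboux type. -/
theorem hasDerivAt_darbouxType {p q : ℕ} {f : Fin p → MvPolynomial (Fin 3) ℂ} {e : Fin p → ℂ}
    {g h : Fin q → MvPolynomial (Fin 3) ℂ} {m : Fin q → ℂ} {A B : MvPolynomial (Fin 3) ℂ}
    (hAB : ∀ v, evalAt B v ≠ 0 → (∀ k, evalAt (h k) v ≠ 0) ∧
      ∑ k, m k * (evalAt (g k) v / evalAt (h k) v) = evalAt A v / evalAt B v)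
    {G : (Fin 3 → ℝ) → ℂ} {V : Set (Fin 3 → ℝ)} {ℓ : Fin p → (Fin 3 → ℝ) → ℂ}
    {γ : ℝ → Fin 3 → ℝ} {γ' : Fin 3 → ℝ} {t : ℝ} (hγ : HasDerivAt γ γ' t) (hV : V ∈ 𝓝 (γ t))
    (hℓ : ∀ j, ContinuousOn (ℓ j) V ∧ ∀ w ∈ V, Complex.exp (ℓ j w) = evalAt (f j) w)
    (hG : ∀ w ∈ V, G w = (∏ j, Complex.exp (e j * ℓ j w)) *
      ∏ k, Complex.exp (m k * (evalAt (g k) w / evalAt (h k) w)))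
    (hB : evalAt B (γ t) ≠ 0) :
    G (γ t) ≠ 0 ∧ HasDerivAt (fun τ => G (γ τ))
      (G (γ t) * (∑ j, e j * (dirDeriv (γ t) γ' (f j) / evalAt (f j) (γ t))
        + (dirDeriv (γ t) γ' A * evalAt B (γ t) - evalAt A (γ t) * dirDeriv (γ t) γ' B)
          / evalAt B (γ t) ^ 2)) t := by
  have hVγ : ∀ᶠ τ in 𝓝 t, γ τ ∈ V := hγ.continuousAt hV
  have hBγ : ∀ᶠ τ in 𝓝 t, evalAt B (γ τ) ≠ 0 :=
    hγ.continuousAt ((isOpen_evalAt_ne_zero B).mem_nhds hB)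
  have hexp : ∀ᶠ τ in 𝓝 t, G (γ τ)
      = Complex.exp (∑ j, e j * ℓ j (γ τ) + evalAt A (γ τ) / evalAt B (γ τ)) := by
    filter_upwards [hVγ, hBγ] with τ h1 h2
    rw [hG _ h1, ← Complex.exp_sum, ← Complex.exp_sum, ← Complex.exp_add, (hAB _ h2).2]
  have ht := hexp.self_of_nhds
  refine ⟨ht ▸ Complex.exp_ne_zero _, ?_⟩
  have hlog : ∀ j, HasDerivAt (fun τ => ℓ j (γ τ))
      (dirDeriv (γ t) γ' (f j) / evalAt (f j) (γ t)) t := fun j =>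
    hasDerivAt_of_exp_eq (F := fun τ => evalAt (f j) (γ τ))
      (((hℓ j).1.continuousAt hV).comp hγ.continuousAt)
      (hVγ.mono fun τ hτ => (hℓ j).2 _ hτ) (hasDerivAt_evalAt hγ (f j))
  have hsum : HasDerivAt (fun τ => ∑ j, e j * ℓ j (γ τ))
      (∑ j, e j * (dirDeriv (γ t) γ' (f j) / evalAt (f j) (γ t))) t :=
    HasDerivAt.fun_sum fun j _ => (hlog j).const_mul (e j)
  rw [ht]
  exact (hsum.add (hasDerivAt_div hγ A hB)).cexp.congr_of_eventuallyEq hexp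

theorem not_hasDarbouxFirstIntegral {α β κ lam : ℝ} (hα : α ≠ 0) (hβ : β ≠ 0) (hκ : κ ≠ 0) :
    ¬ HasDarbouxFirstIntegral α β κ lam := by
  rintro ⟨U, G, hG, p, q, f, e, g, h, m, hf, hgh, hform⟩
  obtain ⟨A, B, hB0, hAB⟩ := exists_common_denominator g h m fun k => (hgh k).1
  have hf0 : ∀ j, f j ≠ 0 := fun j h0 => (hf j).1 0 (by rw [h0, C_0])
  have heigen : ∀ j, ∃ a : ℕ, fieldOp α β κ lam (f j) = C (-lam * a : ℂ) * f j ∧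
      a ≠ 0 ∧ κ = lam := by
    intro j
    obtain ⟨hnc, K, hK⟩ := hf j
    obtain ⟨a, rfl, h1, h2⟩ := fieldOp_cofactor hα hβ (hf0 j) hK
    have ha : a ≠ 0 := fun ha => by
      obtain ⟨c, hc⟩ := h2 ha
      exact hnc c hc
    exact ⟨a, hK, ha, h1 (Nat.one_le_iff_ne_zero.mpr ha)⟩
  choose a hXf ha hκl using heigen
  set Q := (∏ j, f j) * B with hQ
  have hQ0 : Q ≠ 0 := mul_ne_zero (Finset.prod_ne_zero_iff.mpr fun j _ => hf0 j) hB0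
  have hQf : ∀ v, evalAt Q v ≠ 0 → (∀ j, evalAt (f j) v ≠ 0) ∧ evalAt B v ≠ 0 := by
    intro v hv
    rw [hQ, evalAt_mul] at hv
    refine ⟨fun j hj => left_ne_zero_of_mul hv ?_, right_ne_zero_of_mul hv⟩
    rw [evalAt, map_prod]
    exact Finset.prod_eq_zero (Finset.mem_univ j) hj
  have hderiv : ∀ (γ : ℝ → Fin 3 → ℝ) (γ' : Fin 3 → ℝ) (t : ℝ), HasDerivAt γ γ' t → γ t ∈ U →
      evalAt Q (γ t) ≠ 0 → G (γ t) ≠ 0 ∧ HasDerivAt (fun τ => G (γ τ))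
      (G (γ t) * (∑ j, e j * (dirDeriv (γ t) γ' (f j) / evalAt (f j) (γ t))
        + (dirDeriv (γ t) γ' A * evalAt B (γ t) - evalAt A (γ t) * dirDeriv (γ t) γ' B)
          / evalAt B (γ t) ^ 2)) t := by
    intro γ γ' t hγ hU hQt
    obtain ⟨hfv, hBv⟩ := hQf _ hQt
    obtain ⟨V, hV, ℓ, hℓ, hGV⟩ := hform _ hU hfv (hAB _ hBv).1
    exact hasDerivAt_darbouxType hAB hγ hV hℓ hGV hBv
  have hWopen : IsOpen (U ∩ {v | evalAt Q v ≠ 0}) := hG.isOpen.inter (isOpen_evalAt_ne_zero Q)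
  obtain ⟨v₀, hv₀, hv₀Q⟩ := exists_evalAt_ne_zero hQ0 hG.isOpen hG.isConnected.nonempty
  have hident : fieldOp α β κ lam A * B - A * fieldOp α β κ lam B
      = C (lam * ∑ j, e j * a j) * B ^ 2 := by
    rw [← sub_eq_zero]
    refine eq_zero_of_evalAt_eq_zero hWopen ⟨v₀, hv₀, hv₀Q⟩ ?_
    rintro v ⟨hvU, hvQ⟩
    obtain ⟨γ, rfl, hγ, hγG⟩ := hG.exists_curve hvU
    obtain ⟨hG0, hd⟩ := hderiv γ _ 0 hγ hvU hvQ
    obtain ⟨hfv, hBv⟩ := hQf _ hvQ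
    have h1 := (mul_eq_zero.mp (hd.unique hγG)).resolve_left hG0
    have h2 : ∀ j, dirDeriv (γ 0) (vectorField α β κ lam (γ 0)) (f j) / evalAt (f j) (γ 0)
        = -lam * a j := by
      intro j
      rw [← evalAt_fieldOp, hXf, evalAt_mul, evalAt_C, mul_div_cancel_right₀ _ (hfv j)]
    simp only [h2] at h1
    simp only [← evalAt_fieldOp] at h1
    have h3 : ∑ j, e j * (-lam * a j : ℂ) = -(lam * ∑ j, e j * a j) := by
      rw [Finset.mul_sum, ← Finset.sum_neg_distrib]
      exact Finset.sum_congr rfl fun j _ => by ring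
    rw [h3] at h1
    field_simp at h1
    simp only [evalAt_sub, evalAt_mul, evalAt_pow, evalAt_C]
    linear_combination h1
  obtain ⟨c, rfl⟩ := eq_C_mul_of_fieldOp_div hα hβ hκ hB0 hident
  have hsum : (lam : ℂ) * ∑ j, e j * a j = 0 := by
    have hz : fieldOp α β κ lam (C c * B) * B - C c * B * fieldOp α β κ lam B = 0 := by
      simp only [fieldOp, pderiv_C_mul]; ring
    rw [hz] at hident
    have := (mul_eq_zero.mp hident.symm).resolve_right (pow_ne_zero 2 hB0)
    exact C_eq_zero.mp this
  obtain ⟨v, hv, w, hw, hne⟩ := hG.nonconstant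
  refine hne (eq_of_hasDerivAt_zero hG.isOpen hG.isConnected hG.continuousOn hQ0 ?_ v hv w hw)
  intro γ γ' t hγ hU hQt
  obtain ⟨hfv, hBv⟩ := hQf _ hQt
  refine (hderiv γ γ' t hγ hU hQt).2.congr_deriv ?_
  -- After multiplication by `a k`, every logarithmic derivative becomes `a j` times that of the
  -- fixed `f k`, and `∑ e j * a j = 0`. A Darboux polynomial exists here, so `lam = κ ≠ 0` may be
  -- cancelled.
  have hzero : ∑ j, e j * (dirDeriv (γ t) γ' (f j) / evalAt (f j) (γ t)) = 0 := by
    rcases isEmpty_or_nonempty (Fin p) with hp | ⟨⟨k⟩⟩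
    · simp
    · have hlam : (lam : ℂ) ≠ 0 := by
        have := hκl k ▸ hκ
        exact_mod_cast this
      have hak : (a k : ℂ) ≠ 0 := by exact_mod_cast ha k
      have hea := (mul_eq_zero.mp hsum).resolve_left hlam
      apply mul_left_cancel₀ hak
      rw [mul_zero, Finset.mul_sum]
      calc _ = ∑ j, (e j * a j) * (dirDeriv (γ t) γ' (f k) / evalAt (f k) (γ t)) := by
            refine Finset.sum_congr rfl fun j _ => ?_
            have := dirDeriv_div_eq hα hβ hκ (hf0 k) (hXf j) (hXf k) γ' (hfv j) (hfv k)
            linear_combination e j * this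
        _ = 0 := by rw [← Finset.sum_mul, hea, zero_mul]
  rw [hzero, dirDeriv_mul, dirDeriv_C, evalAt_mul, evalAt_C]
  ring

end HSA

theorem mainTheorem3 (α β κ lam : ℝ) (hα : α ≠ 0) (hβ : β ≠ 0) (hκ : κ ≠ 0) :
    ¬ HSA.HasPolynomialFirstIntegral α β κ lam ∧
      ¬ HSA.HasRationalFirstIntegral α β κ lam ∧
      ¬ HSA.HasDarbouxFirstIntegral α β κ lam :=
  ⟨HSA.not_hasPolynomialFirstIntegral hα hβ hκ, HSA.not_hasRationalFirstIntegral hα hβ hκ,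
    HSA.not_hasDarbouxFirstIntegral hα hβ hκ⟩
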